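/- Let $(\Omega,\mu)$ be a measure space. A density is a $\mu$-integrable $p$ with $p>0$ $\mu$-a.e. and $\int p\,d\mu=1$ (identified when equal $\mu$-a.e.). Let $\Phi(x)=\cosh x-1$ with convex conjugate $\Psi$. For a density $p$, $L^\Phi(p)$ and $L^\Psi(p)$ are the Orlicz spaces of $p\cdot\mu$; $B_p=L^\Phi_0(p)$ and ${}^*B_p=L^\Psi_0(p)$ are their subspaces of $p$-centered elements, $B_p$ with the Luxemburg norm, in duality by $\langle u,v\rangle_p=\mathbb E_p[uv]$. Let $\mathcal S_p$ be the interior in $B_p$ of $\{u:\mathbb E_p[e^u]<\infty\}$, $K_p(u)=\log\mathbb E_p[e^u]$, $e_p(u)=e^{u-K_p(u)}p$ for $u\in\mathcal S_p$, $\mathcal E=\mathcal E(p)=e_p(\mathcal S_p)$ the maximal exponential family, and $s_p(q)=\log\frac qp-\mathbb E_p[\log\frac qp]$ the chart at $p$ (the inverse of $e_p$); for each $q\in\mathcal E$, $s_q$ is a chart of $\mathcal E$. The gradient $\nabla K_p(u)\in{}^*B_p$ represents the Fréchet derivative of $K_p$ at $u \in \mathcal S_p$ in the duality. For a closed subspace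 $V_p\subset B_p$ and $q\in\mathcal E$ put $V_q=\{U-\mathbb E_q[U]:U\in V_p\}\subset B_q$, $V_q^\perp=\{v\in{}^*B_q:\mathbb E_q[uv]=0\ \forall u\in V_q\}$, $$\mathrm{EF}(V_p)=\{q\in\mathcal E:s_p(q)\in V_p\},\qquad \mathrm{MF}(V_p)=\{q\in\mathcal E:\mathbb E_q[U]=0\ \forall U\in V_p\}.$$ A regular curve is $t\mapsto \gamma(t)=e_p(u(t))$ on an open interval $I$, with $u\in C^1(I;B_p)$ and values in $\mathcal S_p$. Its score at $t$ is the $W\in B_{\gamma(t)}$ such that $\frac{d}{dt}\mathbb E_{\gamma(t)}[V]=\mathbb E_{\gamma(t)}[(V-\mathbb E_{\gamma(t)}[V])W]$ for all $V\in L^\Phi(\gamma(t))$. For $\mathcal N\subset\mathcal E$ and $q\in\mathcal N$, the tangent space $T_q\mathcal N$ is the set of scores at $q$ of the regular curves through $q$ contained in $\mathcal N$. $\mathcal N$ is a sub-manifold of $\mathcal E$ if for every $q\in\mathcal N$ there are a splitting $B_q=V^1\oplus V^2$ into closed complementary subspaces and a $C^\infty$ diffeomorphism of a neighbourhood of $q$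 in $\mathcal E$ onto a product $O_1\times O_2$ of open sets of $V^1$ and $V^2$, mapping the part of $\mathcal N$ in the neighbourhood onto $O_1\times\{0\}$. Let $p$ be a density and $V_p$ a closed subspace of $B_p$. Then: 1. $\mathrm{EF}(V_p)\cap\mathrm{MF}(V_p)=\{p\}$. 2. For every $q\in\mathrm{EF}(V_p)$, the set of scores at $q$ of regular curves in $\mathrm{EF}(V_p)$ is $V_q$. 3. If a regular curve through $r$ is contained in $\mathrm{MF}(V_p)$, then its score at $r$ exists, is unique, and belongs to $V_r^\perp$. 4. If $V^1_p=V_p$ splits in $B_p$ with complementary space $V_p^2$, then $\mathrm{EF}(V_p^1)$ and $\mathrm{EF}(V_p^2)$ are sub-manifolds of $\mathcal E$ with tangent spaces at $p$ equal to $V_p^1$ and $V_p^2$ respectively. 5. Suppose that $V^1_p=V_p$ splits in $B_p$ with a complementary space $V_p^2$ orthogonal to it, $V_p^2\subset (V_p^1)^\perp$, with projections $\Pi_1,\Pi_2$, and that around $p$ the mapping $$q\mapsto u=s_p(q)\mapsto\bigl(\Pi_1u,(\nabla K_p)^{-1}(\Pi_2u)\bigr)\in V_p^1\times B_p$$ is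 defined and is a $C^\infty$ diffeomorphism onto its image (it is $C^\infty$, with an inverse that is the restriction of a $C^\infty$ map defined on an open set). Then $T_p\,\mathrm{MF}(V_p)=V_p^2$ and there is an open neighbourhood $\mathcal W$ of $p$ in $\mathcal E$ such that $\mathrm{MF}(V_p)\cap\mathcal W$ is a sub-manifold of $\mathcal E$. If, moreover, for every $q\in\mathrm{MF}(V_p)$ the same assumption holds at $q$ for $V_q$ and some complementary space $V_q^2\subset V_q^\perp$, then the whole of $\mathrm{MF}(V_p)$ is a sub-manifold of $\mathcal E$, with $T_q\,\mathrm{MF}(V_p)=V_q^2$ for every $q \in \mathrm{MF}(V_p)$. -/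

import Mathlib

open MeasureTheory Set
open scoped ContDiff

noncomputable section

namespace ExpManifold

variable {Ω : Type*} [MeasurableSpace Ω] {μ : Measure Ω}

/-- Strictly positive probability densities with respect to `μ`, identified when they agree
`μ`-almost everywhere. -/
@[ext]
structure PosDensity {Ω : Type*} [MeasurableSpace Ω] (μ : Measure Ω) where
  /-- The density, as a class of functions modulo `μ`-a.e. equality. -/
  dens : Ω →ₘ[μ] ℝ
  pos : ∀ᵐ x ∂μ, 0 < dens x
  integrable : Integrable dens μ
  integral_eq_one : ∫ x, dens x ∂μ = 1

/-- The probability measure `p · μ`. -/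
def PosDensity.measure (p : PosDensity μ) : Measure Ω :=
  μ.withDensity fun x => ENNReal.ofReal (p.dens x)

lemma PosDensity.absolutelyContinuous (p : PosDensity μ) : μ ≪ p.measure := by
  have hm : AEMeasurable (fun x => ENNReal.ofReal (p.dens x)) μ :=
    p.dens.aestronglyMeasurable.aemeasurable.ennreal_ofReal
  refine withDensity_absolutelyContinuous' hm ?_
  filter_upwards [p.pos] with x hx
  simpa using hx

lemma PosDensity.measure_absolutelyContinuous (p : PosDensity μ) : p.measure ≪ μ :=
  withDensity_absolutelyContinuous _ _

instance (p : PosDensity μ) : IsProbabilityMeasure p.measure := by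
  constructor
  rw [PosDensity.measure, withDensity_apply _ MeasurableSet.univ, Measure.restrict_univ,
    ← ofReal_integral_eq_lintegral_ofReal p.integrable (p.pos.mono fun x hx => hx.le),
    p.integral_eq_one, ENNReal.ofReal_one]

/-- The expectation `𝔼_p[U]` of a random variable. -/
def expect (p : PosDensity μ) (U : Ω →ₘ[μ] ℝ) : ℝ := ∫ x, U x ∂p.measure

/-! ### Orlicz spaces -/

/-- The Young function `Φ = cosh - 1`. -/
def Phi (x : ℝ) : ℝ := Real.cosh x - 1

/-- The conjugate Young function `Ψ(y) = ∫₀^|y| (Φ')⁻¹(v) dv`. -/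
def Psi (y : ℝ) : ℝ := ∫ v in (0 : ℝ)..|y|, Real.arsinh v

/-- `𝔼_p[Y(U)]` as an extended nonnegative number. -/
def modular (Y : ℝ → ℝ) (p : PosDensity μ) (U : Ω →ₘ[μ] ℝ) : ENNReal :=
  ∫⁻ x, ENNReal.ofReal (Y (U x)) ∂p.measure

/-- The Orlicz space `L^Y(p)`: random variables with `𝔼_p[Y(α U)] < ∞` for some `α > 0`. -/
def orlicz (Y : ℝ → ℝ) (p : PosDensity μ) : Set (Ω →ₘ[μ] ℝ) :=
  {U | ∃ α : ℝ, 0 < α ∧ modular Y p (α • U) < ⊤}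

/-- `L^Y_0(p)`: the `p`-centered elements of `L^Y(p)`. For `Y = Psi` this is the pre-dual
space of the model space at `p`. -/
def orliczCentered (Y : ℝ → ℝ) (p : PosDensity μ) : Set (Ω →ₘ[μ] ℝ) :=
  {U | U ∈ orlicz Y p ∧ expect p U = 0}

lemma Phi_nonneg (x : ℝ) : 0 ≤ Phi x := sub_nonneg.2 (Real.one_le_cosh x)

lemma Phi_neg (x : ℝ) : Phi (-x) = Phi x := by simp [Phi]

lemma continuous_Phi : Continuous Phi := Real.continuous_cosh.sub continuous_const

lemma convexOn_Phi : ConvexOn ℝ univ Phi := by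
  have h : Phi = fun x => (1 / 2 : ℝ) • Real.exp x + (1 / 2 : ℝ) • Real.exp (-x) + (-1) := by
    funext x; simp [Phi, Real.cosh_eq]; ring
  rw [h]
  have h2 : ConvexOn ℝ univ fun x : ℝ => Real.exp (-x) := by
    refine ⟨convex_univ, fun x _ y _ a b ha hb hab => ?_⟩
    have := convexOn_exp.2 (mem_univ (-x)) (mem_univ (-y)) ha hb hab
    simp only [smul_eq_mul] at this ⊢
    convert this using 2
    ring
  exact ((convexOn_exp.smul (by norm_num)).add (h2.smul (by norm_num))).add_const (-1)

lemma Phi_smul_le {a : ℝ} (ha : 0 ≤ a) (ha1 : a ≤ 1) (x : ℝ) : Phi (a * x) ≤ a * Phi x := by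
  have := convexOn_Phi.2 (mem_univ x) (mem_univ 0) ha (sub_nonneg.2 ha1) (by ring)
  simpa [Phi] using this

lemma sq_half_le_Phi (x : ℝ) : x ^ 2 / 2 ≤ Phi x := by
  have h1 : |x / 2| ≤ Real.sinh |x / 2| := Real.self_le_sinh_iff.2 (abs_nonneg _)
  have h2 : Real.cosh x = Real.cosh (x / 2) ^ 2 + Real.sinh (x / 2) ^ 2 := by
    rw [← Real.cosh_two_mul]; congr 1; ring
  have h3 : Real.sinh |x / 2| ^ 2 = Real.sinh (x / 2) ^ 2 := by
    rw [← Real.abs_sinh, sq_abs]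
  have h4 : |x / 2| ^ 2 ≤ Real.sinh |x / 2| ^ 2 := pow_le_pow_left₀ (abs_nonneg _) h1 2
  rw [sq_abs, h3] at h4
  have h5 := Real.cosh_sq (x / 2)
  unfold Phi
  nlinarith

lemma abs_le_Phi (x : ℝ) : |x| ≤ Phi x + 1 := by
  nlinarith [sq_nonneg (|x| - 1), sq_abs x, sq_half_le_Phi x]

section Modular

variable (p : PosDensity μ)

lemma ae_of_ae {P : Ω → Prop} (h : ∀ᵐ x ∂μ, P x) : ∀ᵐ x ∂p.measure, P x :=
  p.measure_absolutelyContinuous.ae_le h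

lemma coe_add' (U V : Ω →ₘ[μ] ℝ) : ∀ᵐ x ∂p.measure, (U + V) x = U x + V x :=
  ae_of_ae p (AEEqFun.coeFn_add U V)

lemma coe_smul' (c : ℝ) (U : Ω →ₘ[μ] ℝ) : ∀ᵐ x ∂p.measure, (c • U) x = c * U x :=
  ae_of_ae p (AEEqFun.coeFn_smul c U)

lemma aesm (U : Ω →ₘ[μ] ℝ) : AEStronglyMeasurable U p.measure :=
  U.aestronglyMeasurable.mono_ac p.measure_absolutelyContinuous

lemma modular_convex (U V : Ω →ₘ[μ] ℝ) {a b : ℝ} (ha : 0 ≤ a) (hb : 0 ≤ b) (hab : a + b = 1) :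
    modular Phi p (a • U + b • V)
      ≤ ENNReal.ofReal a * modular Phi p U + ENNReal.ofReal b * modular Phi p V := by
  unfold modular
  have hU : AEMeasurable (fun x => ENNReal.ofReal (Phi (U x))) p.measure :=
    (continuous_Phi.comp_aestronglyMeasurable (aesm p U)).aemeasurable.ennreal_ofReal
  have hV : AEMeasurable (fun x => ENNReal.ofReal (Phi (V x))) p.measure :=
    (continuous_Phi.comp_aestronglyMeasurable (aesm p V)).aemeasurable.ennreal_ofReal
  rw [← lintegral_const_mul'' _ hU, ← lintegral_const_mul'' _ hV,
    ← lintegral_add_left' (hU.const_mul _)]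
  refine lintegral_mono_ae ?_
  filter_upwards [coe_add' p (a • U) (b • V), coe_smul' p a U, coe_smul' p b V] with x h1 h2 h3
  rw [h1, h2, h3, ← ENNReal.ofReal_mul ha, ← ENNReal.ofReal_mul hb,
    ← ENNReal.ofReal_add (mul_nonneg ha (Phi_nonneg _)) (mul_nonneg hb (Phi_nonneg _))]
  exact ENNReal.ofReal_le_ofReal (convexOn_Phi.2 (mem_univ _) (mem_univ _) ha hb hab)

lemma modular_zero : modular Phi p (0 : Ω →ₘ[μ] ℝ) = 0 := by
  unfold modular
  rw [lintegral_congr_ae (g := fun _ => 0)]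
  · simp
  · filter_upwards [ae_of_ae p (AEEqFun.coeFn_zero (α := Ω) (β := ℝ) (μ := μ))] with x hx
    simp [hx, Phi]

lemma modular_neg (U : Ω →ₘ[μ] ℝ) : modular Phi p (-U) = modular Phi p U := by
  unfold modular
  refine lintegral_congr_ae ?_
  filter_upwards [ae_of_ae p (AEEqFun.coeFn_neg U)] with x hx
  rw [hx, Pi.neg_apply, Phi_neg]

lemma modular_smul_le (U : Ω →ₘ[μ] ℝ) {a : ℝ} (ha : 0 ≤ a) (ha1 : a ≤ 1) :
    modular Phi p (a • U) ≤ ENNReal.ofReal a * modular Phi p U := by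
  have := modular_convex p U 0 ha (sub_nonneg.2 ha1) (by ring)
  simpa [modular_zero] using this

lemma integrable_of_mem_orlicz {U : Ω →ₘ[μ] ℝ} (h : U ∈ orlicz Phi p) :
    Integrable U p.measure := by
  obtain ⟨α, hα, h⟩ := h
  have hm := (continuous_Phi.comp_aestronglyMeasurable (aesm p (α • U)))
  have h1 : Integrable (fun x => Phi ((α • U : Ω →ₘ[μ] ℝ) x)) p.measure := by
    refine ⟨hm, ?_⟩
    rw [hasFiniteIntegral_iff_ofReal (Filter.Eventually.of_forall fun x => Phi_nonneg _)]
    exact h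
  have h2 : Integrable (α • U : Ω →ₘ[μ] ℝ) p.measure := by
    refine (h1.add (integrable_const 1)).mono' (aesm p _) (Filter.Eventually.of_forall fun x => ?_)
    exact abs_le_Phi _
  have h3 := h2.const_mul α⁻¹
  refine h3.congr ?_
  filter_upwards [coe_smul' p α U] with x hx
  rw [hx, inv_mul_cancel_left₀ hα.ne']

end Modular

/-- `L^Φ_0(p)` as a vector subspace of the space of all random variables. -/
def BSub (p : PosDensity μ) : Submodule ℝ (Ω →ₘ[μ] ℝ) where
  carrier := orliczCentered Phi p
  zero_mem' := by
    refine ⟨⟨1, one_pos, by simp [modular_zero]⟩, ?_⟩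
    unfold expect
    rw [integral_congr_ae (g := fun _ => 0)]
    · simp
    · filter_upwards [ae_of_ae p (AEEqFun.coeFn_zero (α := Ω) (β := ℝ) (μ := μ))] with x hx
      simp [hx]
  add_mem' := by
    rintro U V ⟨hU, hU0⟩ ⟨hV, hV0⟩
    have iU := integrable_of_mem_orlicz p hU
    have iV := integrable_of_mem_orlicz p hV
    constructor
    · obtain ⟨α, hα, hU⟩ := hU
      obtain ⟨β, hβ, hV⟩ := hV
      have hs : 0 < α + β := add_pos hα hβ
      refine ⟨α * β / (α + β), by positivity, ?_⟩
      have e : (α * β / (α + β)) • (U + V)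
          = (β / (α + β)) • (α • U) + (α / (α + β)) • (β • V) := by
        rw [smul_add, smul_smul, smul_smul]
        congr 2 <;> ring
      rw [e]
      refine (modular_convex p _ _ (by positivity) (by positivity) (by field_simp; ring)).trans_lt ?_
      exact ENNReal.add_lt_top.2 ⟨ENNReal.mul_lt_top ENNReal.ofReal_lt_top hU,
        ENNReal.mul_lt_top ENNReal.ofReal_lt_top hV⟩
    · unfold expect at *
      rw [integral_congr_ae (coe_add' p U V), integral_add iU iV, hU0, hV0, add_zero]
  smul_mem' := by
    rintro c U ⟨⟨α, hα, hU⟩, hU0⟩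
    constructor
    · refine ⟨α / (|c| + 1), by positivity, ?_⟩
      have hc : |c| / (|c| + 1) ≤ 1 := by
        rw [div_le_one (by positivity)]; linarith
      have key : modular Phi p ((α / (|c| + 1)) • (|c| • U)) < ⊤ := by
        have e : (α / (|c| + 1)) • (|c| • U) = (|c| / (|c| + 1)) • (α • U) := by
          rw [smul_smul, smul_smul]; congr 1; ring
        rw [e]
        exact (modular_smul_le p _ (by positivity) hc).trans_lt
          (ENNReal.mul_lt_top ENNReal.ofReal_lt_top hU)
      rcases abs_choice c with h | h
      · rwa [h] at key ⊢
      · rw [h] at key ⊢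
        rwa [neg_smul, smul_neg, modular_neg] at key
    · unfold expect at *
      rw [integral_congr_ae (coe_smul' p c U), integral_const_mul, hU0, mul_zero]

/-- The model space `B_p = L^Φ_0(p)`. -/
def B (p : PosDensity μ) : Type _ := BSub p

instance (p : PosDensity μ) : AddCommGroup (B p) := inferInstanceAs (AddCommGroup (BSub p))

instance (p : PosDensity μ) : Module ℝ (B p) := inferInstanceAs (Module ℝ (BSub p))

/-- The inclusion of the model space in the space of random variables. -/
def B.rv {p : PosDensity μ} : B p →ₗ[ℝ] (Ω →ₘ[μ] ℝ) := (BSub p).subtype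

lemma B.rv_injective {p : PosDensity μ} : Function.Injective (B.rv : B p → (Ω →ₘ[μ] ℝ)) :=
  Subtype.val_injective

lemma B.rv_mem {p : PosDensity μ} (U : B p) : B.rv U ∈ orliczCentered Phi p := U.2

/-- The norm of `B_p`: the Luxemburg norm `inf {a > 0 | 𝔼_p[Φ(U / a)] ≤ 1}`. -/
instance (p : PosDensity μ) : Norm (B p) where
  norm U := sInf {a : ℝ | 0 < a ∧ modular Phi p (a⁻¹ • B.rv U) ≤ 1}

/-- The closed modular unit ball of `B_p`. -/
def modBall (p : PosDensity μ) : Set (B p) := {U | modular Phi p (B.rv U) ≤ 1}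

lemma norm_eq_gauge (p : PosDensity μ) (U : B p) : ‖U‖ = gauge (modBall p) U := by
  rw [gauge_def']
  simp only [modBall, mem_ofPred_eq, map_smul]
  rfl

lemma modBall_convex (p : PosDensity μ) : Convex ℝ (modBall p) := by
  intro U hU V hV a b ha hb hab
  change modular Phi p (B.rv (a • U + b • V)) ≤ 1
  rw [map_add, map_smul, map_smul]
  refine (modular_convex p _ _ ha hb hab).trans ?_
  calc _ ≤ ENNReal.ofReal a * 1 + ENNReal.ofReal b * 1 := by
        gcongr
        · exact hU
        · exact hV
    _ = 1 := by rw [mul_one, mul_one, ← ENNReal.ofReal_add ha hb, hab, ENNReal.ofReal_one]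

lemma modBall_neg (p : PosDensity μ) {U : B p} (hU : U ∈ modBall p) : -U ∈ modBall p := by
  have h := modular_neg p (B.rv U)
  rw [← map_neg] at h
  exact h.trans_le hU

lemma modBall_balanced (p : PosDensity μ) : Balanced ℝ (modBall p) := by
  rw [balanced_iff_smul_mem]
  intro a ha U hU
  have h : modular Phi p (|a| • B.rv U) ≤ 1 := by
    refine (modular_smul_le p _ (abs_nonneg a) ha).trans ?_
    calc _ ≤ 1 * (1 : ENNReal) := by
          gcongr
          · exact ENNReal.ofReal_le_one.2 ha
          · exact hU
      _ = 1 := one_mul 1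
  have h' : |a| • U ∈ modBall p := by
    change modular Phi p (B.rv (|a| • U)) ≤ 1
    rwa [map_smul]
  rcases abs_choice a with e | e
  · rwa [e] at h'
  · rw [e, neg_smul] at h'
    simpa using modBall_neg p h'

lemma modBall_absorbent (p : PosDensity μ) : Absorbent ℝ (modBall p) := by
  rw [absorbent_iff_eventually_nhdsNE_zero]
  intro U
  obtain ⟨⟨α, hα, hU⟩, -⟩ := B.rv_mem U
  set M := modular Phi p (α • B.rv U) with hM
  have hT : 0 < M.toReal + 1 := by positivity
  have h1 : (α / (M.toReal + 1)) • U ∈ modBall p := by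
    have e : (α / (M.toReal + 1)) • B.rv U
        = (M.toReal + 1)⁻¹ • (α • B.rv U) := by
      rw [smul_smul]; congr 1; ring
    change modular Phi p (B.rv ((α / (M.toReal + 1)) • U)) ≤ 1
    rw [map_smul, e]
    refine (modular_smul_le p _ (by positivity) (inv_le_one_of_one_le₀ (by simp))).trans ?_
    have hMe : M = ENNReal.ofReal M.toReal := (ENNReal.ofReal_toReal hU.ne).symm
    rw [← hM]
    nth_rewrite 2 [hMe]
    rw [← ENNReal.ofReal_mul (by positivity)]
    refine ENNReal.ofReal_le_one.2 ?_
    rw [inv_mul_le_iff₀ hT]; linarith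
  have hr : 0 < α / (M.toReal + 1) := by positivity
  refine Filter.Eventually.filter_mono nhdsWithin_le_nhds ?_
  filter_upwards [Metric.ball_mem_nhds (0 : ℝ) hr] with c hc
  have hc' : |c| < α / (M.toReal + 1) := by simpa using hc
  have : c • U = (c / (α / (M.toReal + 1))) • ((α / (M.toReal + 1)) • U) := by
    rw [smul_smul, div_mul_cancel₀ _ hr.ne']
  rw [this]
  refine (balanced_iff_smul_mem.1 (modBall_balanced p)) ?_ h1
  rw [Real.norm_eq_abs, abs_div, abs_of_pos hr, div_le_one hr]
  exact hc'.le

lemma B_core (p : PosDensity μ) : NormedSpace.Core ℝ (B p) where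
  norm_nonneg U := by rw [norm_eq_gauge]; exact gauge_nonneg U
  norm_smul c U := by
    rw [norm_eq_gauge, norm_eq_gauge]; exact gauge_smul (modBall_balanced p) c U
  norm_triangle U V := by
    simp only [norm_eq_gauge]; exact gauge_add_le (modBall_convex p) (modBall_absorbent p) U V
  norm_eq_zero_iff U := by
    rw [norm_eq_gauge]
    constructor
    · intro h
      have hball : ∀ n : ℕ, ((n : ℝ) + 1) • U ∈ modBall p := by
        intro n
        have h1 : gauge (modBall p) (((n : ℝ) + 1) • U) < 1 := by
          rw [gauge_smul (modBall_balanced p), h, mul_zero]; exact one_pos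
        exact setOfPred_gauge_lt_one_subset_self (modBall_convex p) (modBall_absorbent p).zero_mem
          (modBall_absorbent p) h1
      have hle : ∀ n : ℕ, ((n : ENNReal) + 1) * modular Phi p (B.rv U) ≤ 1 := by
        intro n
        have hn : (0 : ℝ) < (n : ℝ) + 1 := by positivity
        have h2 := modular_smul_le p (((n : ℝ) + 1) • B.rv U)
          (a := ((n : ℝ) + 1)⁻¹) (by positivity) (inv_le_one_of_one_le₀ (by simp))
        rw [smul_smul, inv_mul_cancel₀ hn.ne', one_smul] at h2
        have h3 : modular Phi p (((n : ℝ) + 1) • B.rv U) ≤ 1 := by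
          rw [← map_smul]; exact hball n
        have e : ((n : ENNReal) + 1) = ENNReal.ofReal ((n : ℝ) + 1) := by
          rw [ENNReal.ofReal_add (by positivity) zero_le_one, ENNReal.ofReal_natCast,
            ENNReal.ofReal_one]
        calc ((n : ENNReal) + 1) * modular Phi p (B.rv U)
            ≤ ENNReal.ofReal ((n : ℝ) + 1) * (ENNReal.ofReal ((n : ℝ) + 1)⁻¹ * 1) := by
              rw [e]; gcongr; exact h2.trans (by gcongr)
          _ = 1 := by
              rw [mul_one, ← ENNReal.ofReal_mul hn.le, mul_inv_cancel₀ hn.ne', ENNReal.ofReal_one]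
      have hz : modular Phi p (B.rv U) = 0 := by
        by_contra hne
        have htop : modular Phi p (B.rv U) ≠ ⊤ := by
          have := hle 0
          simp only [Nat.cast_zero, zero_add, one_mul] at this
          exact (this.trans_lt ENNReal.one_lt_top).ne
        obtain ⟨n, hn⟩ := ENNReal.exists_nat_mul_gt hne ENNReal.one_ne_top
        refine absurd (hle n) (not_le.2 (hn.trans_le ?_))
        gcongr
        exact le_self_add
      have hae : ∀ᵐ x ∂p.measure, ENNReal.ofReal (Phi (B.rv U x)) = 0 := by
        have hm : AEMeasurable (fun x => ENNReal.ofReal (Phi (B.rv U x))) p.measure :=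
          (continuous_Phi.comp_aestronglyMeasurable (aesm p _)).aemeasurable.ennreal_ofReal
        exact (lintegral_eq_zero_iff' hm).1 hz
      have hae' : ∀ᵐ x ∂μ, ENNReal.ofReal (Phi (B.rv U x)) = 0 :=
        p.absolutelyContinuous.ae_le hae
      apply B.rv_injective
      apply AEEqFun.ext
      filter_upwards [hae', AEEqFun.coeFn_zero (α := Ω) (β := ℝ) (μ := μ)] with x hx h0
      rw [ENNReal.ofReal_eq_zero] at hx
      have hsq := sq_half_le_Phi (B.rv U x)
      have hx0 : B.rv U x = 0 := by
        nlinarith [sq_nonneg (B.rv U x)]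
      rw [hx0, map_zero, h0]; rfl
    · rintro rfl; exact gauge_zero

instance (p : PosDensity μ) : NormedAddCommGroup (B p) := NormedAddCommGroup.ofCore (B_core p)

instance (p : PosDensity μ) : NormedSpace ℝ (B p) := NormedSpace.ofCore (B_core p)

/-! ### The exponential manifold -/

/-- The domain `𝒮_p`: the interior in `B_p` of the set where `𝔼_p[e^U]` is finite. -/
def S (p : PosDensity μ) : Set (B p) :=
  interior {U | ∫⁻ x, ENNReal.ofReal (Real.exp (B.rv U x)) ∂p.measure < ⊤}

/-- The cumulant generating functional `K_p(U) = log 𝔼_p[e^U]`; it is only used on `S p`. -/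
def K (p : PosDensity μ) (U : B p) : ℝ :=
  Real.log (∫ x, Real.exp (B.rv U x) ∂p.measure)

/-- The function `e^{U - K_p(U)} · p`, modulo `μ`-a.e. equality. -/
def expDens (p : PosDensity μ) (U : B p) : Ω →ₘ[μ] ℝ :=
  AEEqFun.mk (fun x => Real.exp (B.rv U x - K p U) * p.dens x)
    ((Real.continuous_exp.comp_aestronglyMeasurable
      ((B.rv U).aestronglyMeasurable.sub aestronglyMeasurable_const)).mul
      p.dens.aestronglyMeasurable)

lemma coeFn_expDens (p : PosDensity μ) (U : B p) :
    ∀ᵐ x ∂μ, expDens p U x = Real.exp (B.rv U x - K p U) * p.dens x :=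
  AEEqFun.coeFn_mk _ _

lemma integrable_exp_of_mem_S {p : PosDensity μ} {U : B p} (hU : U ∈ S p) :
    Integrable (fun x => Real.exp (B.rv U x)) p.measure := by
  have h : U ∈ {U : B p |
      ∫⁻ x, ENNReal.ofReal (Real.exp (B.rv U x)) ∂p.measure < ⊤} := interior_subset hU
  refine ⟨Real.continuous_exp.comp_aestronglyMeasurable (aesm p _), ?_⟩
  rw [hasFiniteIntegral_iff_ofReal (Filter.Eventually.of_forall fun x => (Real.exp_pos _).le)]
  exact h

lemma integral_measure (p : PosDensity μ) (f : Ω → ℝ) :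
    ∫ x, f x ∂p.measure = ∫ x, f x * p.dens x ∂μ := by
  have hm : AEMeasurable (fun x => (p.dens x).toNNReal) μ :=
    p.dens.aestronglyMeasurable.aemeasurable.real_toNNReal
  have : p.measure = μ.withDensity fun x => (((p.dens x).toNNReal : NNReal) : ENNReal) := rfl
  rw [this, integral_withDensity_eq_integral_smul₀ hm]
  refine integral_congr_ae ?_
  filter_upwards [p.pos] with x hx
  rw [NNReal.smul_def, Real.coe_toNNReal _ hx.le, smul_eq_mul, mul_comm]

lemma integrable_measure (p : PosDensity μ) {f : Ω → ℝ} (hf : Integrable f p.measure) :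
    Integrable (fun x => f x * p.dens x) μ := by
  have hm : AEMeasurable (fun x => (p.dens x).toNNReal) μ :=
    p.dens.aestronglyMeasurable.aemeasurable.real_toNNReal
  have e : p.measure = μ.withDensity fun x => (((p.dens x).toNNReal : NNReal) : ENNReal) := rfl
  rw [e, integrable_withDensity_iff_integrable_smul₀ hm] at hf
  refine hf.congr ?_
  filter_upwards [p.pos] with x hx
  rw [NNReal.smul_def, Real.coe_toNNReal _ hx.le, smul_eq_mul, mul_comm]

/-- The parametrization `e_p : 𝒮_p → 𝓔(p)`, `e_p(U) = e^{U - K_p(U)} · p`. -/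
def expMap (p : PosDensity μ) (U : S p) : PosDensity μ where
  dens := expDens p U.1
  pos := by
    filter_upwards [coeFn_expDens p U.1, p.pos] with x hx hp
    rw [hx]
    exact mul_pos (Real.exp_pos _) hp
  integrable := by
    have h := integrable_measure p ((integrable_exp_of_mem_S U.2).div_const (Real.exp (K p U.1)))
    refine h.congr ?_
    filter_upwards [coeFn_expDens p U.1] with x hx
    rw [hx, Real.exp_sub]
  integral_eq_one := by
    have hi := integrable_exp_of_mem_S U.2
    have hpos : 0 < ∫ x, Real.exp (B.rv U.1 x) ∂p.measure := integral_exp_pos hi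
    have hK : Real.exp (K p U.1) = ∫ x, Real.exp (B.rv U.1 x) ∂p.measure :=
      Real.exp_log hpos
    have e : ∫ x, expDens p U.1 x ∂μ
        = ∫ x, Real.exp (B.rv U.1 x) / Real.exp (K p U.1) ∂p.measure := by
      rw [integral_measure]
      refine integral_congr_ae ?_
      filter_upwards [coeFn_expDens p U.1] with x hx
      rw [hx, Real.exp_sub]
    rw [e, integral_div, hK, div_self hpos.ne']

/-- The maximal exponential family `𝓔(p)`. -/
def maxExp (p : PosDensity μ) : Set (PosDensity μ) := range (expMap p)

/-- `log (q / p)` as a random variable. -/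
def logRatio (p q : PosDensity μ) : Ω →ₘ[μ] ℝ :=
  AEEqFun.mk (fun x => Real.log (q.dens x / p.dens x))
    (Real.measurable_log.comp_aemeasurable
      (q.dens.aestronglyMeasurable.aemeasurable.div
        p.dens.aestronglyMeasurable.aemeasurable)).aestronglyMeasurable

/-- The chart `s_p(q) = log (q / p) - 𝔼_p[log (q / p)]`. -/
def chart (p q : PosDensity μ) : Ω →ₘ[μ] ℝ :=
  logRatio p q - AEEqFun.const Ω (expect p (logRatio p q))

/-- A subspace of `B_p` seen as a set of random variables. -/
def asRV {p : PosDensity μ} (V : Submodule ℝ (B p)) : Set (Ω →ₘ[μ] ℝ) := B.rv '' (V : Set (B p))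

/-- The exponential transport `U ↦ U - 𝔼_q[U]` to the fibre at `q`. -/
def eTransport (q : PosDensity μ) (U : Ω →ₘ[μ] ℝ) : Ω →ₘ[μ] ℝ :=
  U - AEEqFun.const Ω (expect q U)

/-- The parallel space `V_q`, image of `V_p` under the exponential transport. -/
def parallel {p : PosDensity μ} (V : Submodule ℝ (B p)) (q : PosDensity μ) : Set (Ω →ₘ[μ] ℝ) :=
  eTransport q '' asRV V

/-- The annihilator, in the pre-dual space `L^Ψ_0(q)`, of a set of random variables. -/
def annihilator (q : PosDensity μ) (A : Set (Ω →ₘ[μ] ℝ)) : Set (Ω →ₘ[μ] ℝ) :=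
  {v | v ∈ orliczCentered Psi q ∧ ∀ u ∈ A, expect q (u * v) = 0}

/-- The exponential family of `V_p`. -/
def EF {p : PosDensity μ} (V : Submodule ℝ (B p)) : Set (PosDensity μ) :=
  {q | q ∈ maxExp p ∧ chart p q ∈ asRV V}

/-- The mixture family of `V_p`. -/
def MF {p : PosDensity μ} (V : Submodule ℝ (B p)) : Set (PosDensity μ) :=
  {q | q ∈ maxExp p ∧ ∀ U ∈ V, expect q (B.rv U) = 0}

/-! ### Curves, scores, sub-manifolds -/

/-- `γ`, on the open interval `I`, is a regular curve in `𝓔(p)`: `γ t = e_p(U t)` where `U` is a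
`C¹` curve in `B_p` with values in `𝒮_p`. -/
def IsRegularCurve (p : PosDensity μ) (I : Set ℝ) (γ : ℝ → PosDensity μ) : Prop :=
  IsOpen I ∧ I.OrdConnected ∧ ∃ U : ℝ → B p, ContDiffOn ℝ 1 U I ∧
    ∀ t ∈ I, ∃ h : U t ∈ S p, γ t = expMap p ⟨U t, h⟩

/-- `W` is the score at `t` of the curve `γ`: `W` belongs to the fibre at `γ t` and
`d/dt 𝔼_{γ t}[V] = 𝔼_{γ t}[(V - 𝔼_{γ t}[V]) W]` for all `V ∈ L^Φ(γ t)`. -/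
def IsScoreAt (γ : ℝ → PosDensity μ) (t : ℝ) (W : Ω →ₘ[μ] ℝ) : Prop :=
  W ∈ BSub (γ t) ∧ ∀ V ∈ orlicz Phi (γ t),
    HasDerivAt (fun s => expect (γ s) V) (expect (γ t) (eTransport (γ t) V * W)) t

/-- The tangent space at `q` of a subset `N` of `𝓔(p)`: the scores at `q` of the regular curves
in `N` that pass through `q`. -/
def tangentAt (p : PosDensity μ) (N : Set (PosDensity μ)) (q : PosDensity μ) :
    Set (Ω →ₘ[μ] ℝ) :=
  {W | ∃ (I : Set ℝ) (γ : ℝ → PosDensity μ) (t : ℝ), IsRegularCurve p I γ ∧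
    (∀ s ∈ I, γ s ∈ N) ∧ t ∈ I ∧ γ t = q ∧ IsScoreAt γ t W}

/-- There is a diffeomorphism of a neighbourhood of `q`, written in the chart `s_q`, onto a product
`O₁ × O₂` of open sets of `V₁` and `V₂` that maps the part of `N` in the neighbourhood onto
`O₁ × {0}`. -/
def HasSplittingChartAt (N : Set (PosDensity μ)) (q : PosDensity μ)
    (V₁ V₂ : Submodule ℝ (B q)) : Prop :=
  ∃ (σ : OpenPartialHomeomorph (B q) (V₁ × V₂)) (O₁ : Set V₁) (O₂ : Set V₂),
    (0 : B q) ∈ σ.source ∧ σ.source ⊆ S q ∧ IsOpen O₁ ∧ IsOpen O₂ ∧ σ.target = O₁ ×ˢ O₂ ∧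
    ContDiffOn ℝ ∞ σ σ.source ∧ ContDiffOn ℝ ∞ σ.symm σ.target ∧
    σ '' {u | u ∈ σ.source ∧ ∃ h : u ∈ S q, expMap q ⟨u, h⟩ ∈ N} = O₁ ×ˢ {0}

/-- `N` is a sub-manifold of `𝓔(p)`: around each `q ∈ N` it is flattened by a chart adapted to
some splitting `B_q = V₁ ⊕ V₂` into topologically complementary (hence closed) subspaces. -/
def IsSubmanifold (p : PosDensity μ) (N : Set (PosDensity μ)) : Prop :=
  N ⊆ maxExp p ∧ ∀ q ∈ N, ∃ V₁ V₂ : Submodule ℝ (B q),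
    Submodule.IsTopCompl V₁ V₂ ∧ HasSplittingChartAt N q V₁ V₂

/-- `∇K_p(w) = v`: the Fréchet derivative of `K_p` at `w ∈ 𝒮_p` is represented by the element `v`
of the pre-dual space in the duality `⟨v, V⟩_p = 𝔼_p[v V]`. -/
def IsGradK (p : PosDensity μ) (w : B p) (v : Ω →ₘ[μ] ℝ) : Prop :=
  w ∈ S p ∧ v ∈ orliczCentered Psi p ∧ ∃ L : B p →L[ℝ] ℝ, HasFDerivAt (K p) L w ∧
    ∀ V : B p, L V = expect p (v * B.rv V)

/-- `F` is a `C^∞` diffeomorphism of the open set `O` onto its image: it is `C^∞` and it has an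
inverse that is the restriction of a `C^∞` map defined on an open set. -/
def IsDiffeoOntoImage {E F : Type*} [NormedAddCommGroup E] [NormedSpace ℝ E]
    [NormedAddCommGroup F] [NormedSpace ℝ F] (f : E → F) (O : Set E) : Prop :=
  ContDiffOn ℝ ∞ f O ∧ ∃ (O' : Set F) (g : F → E), IsOpen O' ∧ MapsTo f O O' ∧
    ContDiffOn ℝ ∞ g O' ∧ LeftInvOn g f O

/-- Around `p` the mapping `q ↦ u = s_p(q) ↦ (Π₁ u, (∇K_p)⁻¹ (Π₂ u))` is defined and is a
diffeomorphism onto its image, where `Π₁`, `Π₂` are the projections of the splitting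
`B_p = V₁ ⊕ V₂`. Here `H u` is `(∇K_p)⁻¹ (Π₂ u)`. -/
def IsMixedDiffeoAt (p : PosDensity μ) (V₁ V₂ : Submodule ℝ (B p))
    (h : Submodule.IsTopCompl V₁ V₂) : Prop :=
  ∃ (O : Set (B p)) (H : B p → B p), IsOpen O ∧ (0 : B p) ∈ O ∧ O ⊆ S p ∧
    (∀ u ∈ O, IsGradK p (H u) (B.rv (V₂.projectionL V₁ h.symm u))) ∧
    IsDiffeoOntoImage (fun u => (V₁.projectionOntoL V₂ h u, H u)) O

end ExpManifold

end

noncomputable section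

namespace ExpManifold

variable {Ω : Type*} [MeasurableSpace Ω] {μ : Measure Ω}

/-! ### Elementary estimates and the modular -/

/-! The change of chart from `p` to `q = e_p(w)` is the affine map `u ↦ T(u - w)`, where `T` is
exponential transport. Since `𝒮_p` is open, `E_p[e^{(1+δ)w}]` and `E_p[e^{-δw}]` are finite for some
`δ > 0`, and Young's inequality then bounds the Orlicz norms of `p` and `q` by each other
(`Dominates`). Hence `T` is a linear homeomorphism, and every differential computation can be made
at the centre of a chart (`rebase`).

At the centre, `u ↦ E_q[e^u X]` has derivative `h ↦ E_q[Xh]`, with a quadratic remainder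
(`hasFDerivAt_integral_exp_mul`). So the score of `e_p(U(t))` is the transport of `U'(t)`. It is
unique because `L^Φ ⊂ L²`: a difference of two scores is orthogonal to itself. The exponential
family is an open piece of `V` in the chart, whence its scores and its linear flattening. Along a
curve in the mixture family the means of elements of `V` stay zero, and differentiating gives
orthogonality.

The families meet only at `p` because a centered `w` with zero mean under `e_p(w)` vanishes
(`eq_zero_of_expect_expMap_eq_zero`): the two relative entropies between `p` and `e_p(w)` are then
`K_p(w)` and `-K_p(w)`, both nonnegative.

For the mixture family, `H = (∇K_p)⁻¹` on `V₂` takes values in the family, since `E_{e_p(H b)}[U] =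
E_p[bU] = 0` for `U ∈ V`, and its derivative at `0` is the inclusion of `V₂`. Hence `(b, a) ↦ a +
H(b)` is a local diffeomorphism at `0` by the inverse function theorem, which uses completeness of
`B_p`. The uniqueness of intersection, read at `e_p(H b)`, says that its value is in the family iff
`a = 0` (`exists_isFlattening_MF`). At another `q` of the family, `V_q = V` as random variables and
the mixture family is the same, so the local statement at `q` applies. -/

lemma Phi_le_exp_abs (x : ℝ) : Phi x ≤ Real.exp |x| := by
  have h := Real.cosh_eq |x|
  have h1 : Real.exp (-|x|) ≤ Real.exp |x| :=
    Real.exp_le_exp.2 (by linarith [abs_nonneg x])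
  rw [Real.cosh_abs] at h
  unfold Phi
  linarith

lemma exp_abs_le (x : ℝ) : Real.exp |x| ≤ 2 * Phi x + 2 := by
  have h := Real.cosh_eq |x|
  rw [Real.cosh_abs] at h
  unfold Phi
  linarith [Real.exp_pos (-|x|)]

lemma exp_le_exp_abs (x : ℝ) : Real.exp x ≤ Real.exp |x| := Real.exp_le_exp.2 (le_abs_self x)

lemma integrable_iff_lintegral_ofReal {P : Measure Ω} {f : Ω → ℝ}
    (hf : AEStronglyMeasurable f P) (h0 : ∀ x, 0 ≤ f x) :
    Integrable f P ↔ ∫⁻ x, ENNReal.ofReal (f x) ∂P < ⊤ := by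
  rw [← hasFiniteIntegral_iff_ofReal (Filter.Eventually.of_forall h0)]
  exact ⟨fun h => h.2, fun h => ⟨hf, h⟩⟩

lemma aesm_Phi {P : Measure Ω} {X : Ω → ℝ} (hX : AEStronglyMeasurable X P) :
    AEStronglyMeasurable (fun x => Phi (X x)) P :=
  continuous_Phi.comp_aestronglyMeasurable hX

lemma aesm_exp {P : Measure Ω} {X : Ω → ℝ} (hX : AEStronglyMeasurable X P) :
    AEStronglyMeasurable (fun x => Real.exp (X x)) P :=
  Real.continuous_exp.comp_aestronglyMeasurable hX

lemma aesm_abs {P : Measure Ω} {X : Ω → ℝ} (hX : AEStronglyMeasurable X P) :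
    AEStronglyMeasurable (fun x => |X x|) P :=
  continuous_abs.comp_aestronglyMeasurable hX

lemma modular_lt_top_iff (p : PosDensity μ) (U : Ω →ₘ[μ] ℝ) :
    modular Phi p U < ⊤ ↔ Integrable (fun x => Phi (U x)) p.measure :=
  (integrable_iff_lintegral_ofReal (aesm_Phi (aesm p U)) fun _ => Phi_nonneg _).symm

lemma modular_le_ofReal_iff (p : PosDensity μ) (U : Ω →ₘ[μ] ℝ) {C : ℝ} (hC : 0 ≤ C) :
    modular Phi p U ≤ ENNReal.ofReal C ↔
      Integrable (fun x => Phi (U x)) p.measure ∧ ∫ x, Phi (U x) ∂p.measure ≤ C := by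
  have key (h : Integrable (fun x => Phi (U x)) p.measure) :
      modular Phi p U = ENNReal.ofReal (∫ x, Phi (U x) ∂p.measure) :=
    (ofReal_integral_eq_lintegral_ofReal h (Filter.Eventually.of_forall fun _ => Phi_nonneg _)).symm
  constructor
  · intro h
    have hi := (modular_lt_top_iff p U).1 (h.trans_lt ENNReal.ofReal_lt_top)
    rw [key hi, ENNReal.ofReal_le_ofReal_iff hC] at h
    exact ⟨hi, h⟩
  · rintro ⟨hi, h⟩
    rw [key hi]
    exact ENNReal.ofReal_le_ofReal h

lemma mem_orlicz_iff (p : PosDensity μ) (U : Ω →ₘ[μ] ℝ) :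
    U ∈ orlicz Phi p ↔ ∃ α : ℝ, 0 < α ∧ Integrable (fun x => Phi (α * U x)) p.measure := by
  have e (α : ℝ) : modular Phi p (α • U) < ⊤ ↔
      Integrable (fun x => Phi (α * U x)) p.measure := by
    rw [modular_lt_top_iff]
    refine integrable_congr ?_
    filter_upwards [coe_smul' p α U] with x hx
    rw [hx]
  simp only [orlicz, mem_ofPred_eq, e]

lemma integral_Phi_le_one_of_norm_lt_one {p : PosDensity μ} {U : B p} (hU : ‖U‖ < 1) :
    Integrable (fun x => Phi (B.rv U x)) p.measure ∧ ∫ x, Phi (B.rv U x) ∂p.measure ≤ 1 := by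
  rw [norm_eq_gauge] at hU
  have h : U ∈ modBall p :=
    setOfPred_gauge_lt_one_subset_self (modBall_convex p) (modBall_absorbent p).zero_mem
      (modBall_absorbent p) hU
  refine (modular_le_ofReal_iff p _ zero_le_one).1 ?_
  rw [ENNReal.ofReal_one]
  exact h

lemma integral_exp_abs_le_four {p : PosDensity μ} {U : B p} (hU : ‖U‖ < 1) :
    Integrable (fun x => Real.exp |B.rv U x|) p.measure ∧
      ∫ x, Real.exp |B.rv U x| ∂p.measure ≤ 4 := by
  obtain ⟨hi, hle⟩ := integral_Phi_le_one_of_norm_lt_one hU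
  have h2 : Integrable (fun x => 2 * Phi (B.rv U x) + 2) p.measure :=
    (hi.const_mul 2).add (integrable_const 2)
  have hE : Integrable (fun x => Real.exp |B.rv U x|) p.measure := by
    refine h2.mono' (aesm_exp (aesm_abs (aesm p _))) (Filter.Eventually.of_forall fun x => ?_)
    rw [Real.norm_eq_abs, abs_of_pos (Real.exp_pos _)]
    exact exp_abs_le _
  refine ⟨hE, (integral_mono hE h2 fun x => exp_abs_le _).trans ?_⟩
  rw [integral_add (hi.const_mul 2) (integrable_const 2), integral_const_mul]
  simp
  linarith

/-- Convexity and `Φ(0) = 0`: dividing by `C ≥ 1` divides the modular by at least `C`, so a modular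
bound larger than `1` still bounds the norm. -/
lemma norm_le_of_integral_Phi {p : PosDensity μ} (U : B p) {c C : ℝ} (hc : 0 < c) (hC : 1 ≤ C)
    (hi : Integrable (fun x => Phi (c * B.rv U x)) p.measure)
    (hle : ∫ x, Phi (c * B.rv U x) ∂p.measure ≤ C) : ‖U‖ ≤ C / c := by
  have hC0 : 0 < C := one_pos.trans_le hC
  refine csInf_le ⟨0, fun a ha => ha.1.le⟩ ⟨by positivity, ?_⟩
  have e : (C / c)⁻¹ • B.rv U = C⁻¹ • (c • B.rv U) := by
    rw [smul_smul]; congr 1; field_simp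
  have h1 : modular Phi p (c • B.rv U) ≤ ENNReal.ofReal C := by
    have hae : (fun x => Phi ((c • B.rv U : Ω →ₘ[μ] ℝ) x)) =ᵐ[p.measure]
        fun x => Phi (c * B.rv U x) := by
      filter_upwards [coe_smul' p c (B.rv U)] with x hx
      rw [hx]
    rw [modular_le_ofReal_iff p _ hC0.le, integrable_congr hae, integral_congr_ae hae]
    exact ⟨hi, hle⟩
  rw [e]
  refine (modular_smul_le p _ (by positivity) (inv_le_one_of_one_le₀ hC)).trans ?_
  calc _ ≤ ENNReal.ofReal C⁻¹ * ENNReal.ofReal C := by gcongr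
    _ = 1 := by
      rw [← ENNReal.ofReal_mul (by positivity), inv_mul_cancel₀ hC0.ne', ENNReal.ofReal_one]

/-! ### Square integrability of the elements of `L^Φ` -/

/-- Comes from `Φ(x) ≥ x²/2`. It makes products of two elements of `L^Φ` integrable, so that scores
can be tested against each other. -/
lemma memLp_two_of_mem_orlicz {p : PosDensity μ} {U : Ω →ₘ[μ] ℝ} (h : U ∈ orlicz Phi p) :
    MemLp U 2 p.measure := by
  obtain ⟨α, hα, hi⟩ := (mem_orlicz_iff p U).1 h
  rw [memLp_two_iff_integrable_sq (aesm p U)]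
  refine (hi.const_mul (2 / α ^ 2)).mono' ((aesm p U).pow 2)
    (Filter.Eventually.of_forall fun x => ?_)
  rw [Real.norm_eq_abs, abs_of_nonneg (sq_nonneg _)]
  have := sq_half_le_Phi (α * U x)
  calc U x ^ 2 = 2 / α ^ 2 * ((α * U x) ^ 2 / 2) := by field_simp
    _ ≤ _ := by gcongr

lemma integrable_rv {p : PosDensity μ} (U : B p) : Integrable (B.rv U) p.measure :=
  integrable_of_mem_orlicz p (B.rv_mem U).1

lemma expect_rv {p : PosDensity μ} (U : B p) : expect p (B.rv U) = 0 := (B.rv_mem U).2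

lemma integrable_mul_of_mem_orlicz {p : PosDensity μ} {U W : Ω →ₘ[μ] ℝ} (hU : U ∈ orlicz Phi p)
    (hW : W ∈ orlicz Phi p) : Integrable (fun x => U x * W x) p.measure :=
  (memLp_two_of_mem_orlicz hU).integrable_mul (memLp_two_of_mem_orlicz hW)

/-! ### Pointwise formulas for expectations -/

lemma coe_mul' (p : PosDensity μ) (U V : Ω →ₘ[μ] ℝ) : ∀ᵐ x ∂p.measure, (U * V) x = U x * V x :=
  ae_of_ae p (AEEqFun.coeFn_mul U V)

lemma coe_sub' (p : PosDensity μ) (U V : Ω →ₘ[μ] ℝ) : ∀ᵐ x ∂p.measure, (U - V) x = U x - V x :=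
  ae_of_ae p (AEEqFun.coeFn_sub U V)

lemma coe_const' (p : PosDensity μ) (c : ℝ) :
    ∀ᵐ x ∂p.measure, (AEEqFun.const Ω c : Ω →ₘ[μ] ℝ) x = c :=
  ae_of_ae p (AEEqFun.coeFn_const Ω c)

lemma coe_eTransport (p q : PosDensity μ) (U : Ω →ₘ[μ] ℝ) :
    ∀ᵐ x ∂p.measure, eTransport q U x = U x - expect q U := by
  filter_upwards [coe_sub' p U (AEEqFun.const Ω (expect q U)), coe_const' p (expect q U)]
    with x h1 h2
  rw [eTransport, h1, h2]

lemma ext_of_ae (p : PosDensity μ) {U W : Ω →ₘ[μ] ℝ} (h : ∀ᵐ x ∂p.measure, U x = W x) : U = W :=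
  AEEqFun.ext (p.absolutelyContinuous.ae_le h)

lemma expect_mul (p : PosDensity μ) (U V : Ω →ₘ[μ] ℝ) :
    expect p (U * V) = ∫ x, U x * V x ∂p.measure := integral_congr_ae (coe_mul' p U V)

lemma expect_add {p : PosDensity μ} {U V : Ω →ₘ[μ] ℝ} (hU : Integrable U p.measure)
    (hV : Integrable V p.measure) : expect p (U + V) = expect p U + expect p V := by
  unfold expect
  rw [integral_congr_ae (coe_add' p U V), integral_add hU hV]

lemma expect_smul (p : PosDensity μ) (c : ℝ) (U : Ω →ₘ[μ] ℝ) :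
    expect p (c • U) = c * expect p U := by
  unfold expect
  rw [integral_congr_ae (coe_smul' p c U), integral_const_mul]

lemma expect_sub_const {p : PosDensity μ} {U : Ω →ₘ[μ] ℝ} (hU : Integrable U p.measure) (c : ℝ) :
    expect p (U - AEEqFun.const Ω c) = expect p U - c := by
  have : ∫ x, (U - AEEqFun.const Ω c : Ω →ₘ[μ] ℝ) x ∂p.measure = ∫ x, (U x - c) ∂p.measure := by
    refine integral_congr_ae ?_
    filter_upwards [coe_sub' p U (AEEqFun.const Ω c), coe_const' p c] with x h1 h2
    rw [h1, h2]
  unfold expect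
  rw [this, integral_sub hU (integrable_const c)]
  simp

lemma expect_eTransport {p : PosDensity μ} {U : Ω →ₘ[μ] ℝ} (hU : Integrable U p.measure) :
    expect p (eTransport p U) = 0 := by
  rw [eTransport, expect_sub_const hU, sub_self]

lemma expect_eTransport_mul {p : PosDensity μ} {U W : Ω →ₘ[μ] ℝ} (hU : U ∈ orlicz Phi p)
    (hW : W ∈ BSub p) : expect p (eTransport p U * W) = expect p (U * W) := by
  have hW1 := integrable_of_mem_orlicz p hW.1
  rw [expect_mul, expect_mul]
  have : ∫ x, eTransport p U x * W x ∂p.measure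
      = ∫ x, (U x * W x - expect p U * W x) ∂p.measure := by
    refine integral_congr_ae ?_
    filter_upwards [coe_eTransport p p U] with x h1
    rw [h1, sub_mul]
  rw [this, integral_sub (integrable_mul_of_mem_orlicz hU hW.1) (hW1.const_mul _),
    integral_const_mul]
  have : ∫ x, W x ∂p.measure = 0 := hW.2
  rw [this, mul_zero, sub_zero]

lemma eTransport_eq_self {p : PosDensity μ} {U : Ω →ₘ[μ] ℝ} (h : expect p U = 0) :
    eTransport p U = U := by
  refine ext_of_ae p ?_
  filter_upwards [coe_eTransport p p U] with x hx
  rw [hx, h, sub_zero]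

lemma eTransport_eTransport {p : PosDensity μ} {U : Ω →ₘ[μ] ℝ} (hU : Integrable U p.measure)
    (q : PosDensity μ) : eTransport p (eTransport q U) = eTransport p U := by
  refine ext_of_ae p ?_
  filter_upwards [coe_eTransport p p (eTransport q U), coe_eTransport p q U,
    coe_eTransport p p U] with x h1 h2 h3
  rw [h1, h2, h3, eTransport, expect_sub_const hU]
  ring

lemma eTransport_mem_BSub {p : PosDensity μ} {U : Ω →ₘ[μ] ℝ} (hU : U ∈ orlicz Phi p) :
    eTransport p U ∈ BSub p := by
  refine ⟨?_, expect_eTransport (integrable_of_mem_orlicz p hU)⟩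
  obtain ⟨α, hα, hi⟩ := (mem_orlicz_iff p U).1 hU
  set c := expect p U
  refine (mem_orlicz_iff p _).2 ⟨α / 2, by positivity, ?_⟩
  refine ((hi.const_mul (1 / 2)).add (integrable_const (1 / 2 * Phi (α * c)))).mono'
    (aesm_Phi ((aesm p _).const_mul _)) ?_
  filter_upwards [coe_eTransport p p U] with x hx
  -- Midpoint convexity between `αU` and `-αc`; this is why the scale is halved to `α / 2`.
  have h := convexOn_Phi.2 (mem_univ (α * U x)) (mem_univ (-(α * c)))
    (by norm_num : (0 : ℝ) ≤ 1 / 2) (by norm_num : (0 : ℝ) ≤ 1 / 2) (by norm_num)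
  rw [Phi_neg] at h
  rw [Real.norm_eq_abs, abs_of_nonneg (Phi_nonneg _), hx]
  have e : α / 2 * (U x - c) = 1 / 2 * (α * U x) + 1 / 2 * -(α * c) := by ring
  change Phi (α / 2 * (U x - c)) ≤ 1 / 2 * Phi (α * U x) + 1 / 2 * Phi (α * c)
  rw [e]
  exact h

/-- An element of `B_p` from a random variable in `L^Φ_0(p)`. -/
def B.mk {p : PosDensity μ} (U : Ω →ₘ[μ] ℝ) (hU : U ∈ BSub p) : B p := ⟨U, hU⟩

@[simp] lemma B.rv_mk {p : PosDensity μ} (U : Ω →ₘ[μ] ℝ) (hU : U ∈ BSub p) :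
    B.rv (B.mk U hU) = U := rfl

/-! ### The maximal exponential family in the chart at `p` -/

lemma mem_S_finite {p : PosDensity μ} {U : B p} (hU : ‖U‖ < 1) :
    U ∈ {U : B p | ∫⁻ x, ENNReal.ofReal (Real.exp (B.rv U x)) ∂p.measure < ⊤} := by
  have h := (integral_exp_abs_le_four hU).1
  refine (integrable_iff_lintegral_ofReal (aesm_exp (aesm p _)) fun x => (Real.exp_pos _).le).1 ?_
  refine h.mono' (aesm_exp (aesm p _)) (Filter.Eventually.of_forall fun x => ?_)
  rw [Real.norm_eq_abs, abs_of_pos (Real.exp_pos _)]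
  exact exp_le_exp_abs _

lemma isOpen_S (p : PosDensity μ) : IsOpen (S p) := isOpen_interior

lemma zero_mem_S (p : PosDensity μ) : (0 : B p) ∈ S p := by
  refine mem_interior.2 ⟨Metric.ball 0 1, fun U hU => mem_S_finite (by simpa using hU),
    Metric.isOpen_ball, Metric.mem_ball_self one_pos⟩

lemma exp_K {p : PosDensity μ} {U : B p} (hU : U ∈ S p) :
    Real.exp (K p U) = ∫ x, Real.exp (B.rv U x) ∂p.measure :=
  Real.exp_log (integral_exp_pos (integrable_exp_of_mem_S hU))

lemma coe_zero_rv (p : PosDensity μ) : ∀ᵐ x ∂μ, B.rv (0 : B p) x = 0 := by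
  rw [map_zero]
  exact AEEqFun.coeFn_zero

lemma K_zero (p : PosDensity μ) : K p 0 = 0 := by
  unfold K
  rw [integral_congr_ae (g := fun _ => 1)]
  · simp
  · filter_upwards [ae_of_ae p (coe_zero_rv p)] with x hx
    rw [hx, Real.exp_zero]

lemma expMap_dens {p : PosDensity μ} (w : S p) :
    ∀ᵐ x ∂μ, (expMap p w).dens x = Real.exp (B.rv w.1 x - K p w.1) * p.dens x :=
  coeFn_expDens p w.1

lemma PosDensity.ext_ae {p q : PosDensity μ} (h : ∀ᵐ x ∂μ, p.dens x = q.dens x) : p = q :=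
  PosDensity.ext (AEEqFun.ext h)

lemma expMap_zero (p : PosDensity μ) (h : (0 : B p) ∈ S p) : expMap p ⟨0, h⟩ = p := by
  refine PosDensity.ext_ae ?_
  filter_upwards [expMap_dens (⟨0, h⟩ : S p), coe_zero_rv p] with x h1 h2
  rw [h1, h2, K_zero]
  simp

lemma logRatio_expMap {p : PosDensity μ} (w : S p) :
    ∀ᵐ x ∂μ, logRatio p (expMap p w) x = B.rv w.1 x - K p w.1 := by
  have h : ∀ᵐ x ∂μ, logRatio p (expMap p w) x = Real.log ((expMap p w).dens x / p.dens x) :=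
    AEEqFun.coeFn_mk _ _
  filter_upwards [h, expMap_dens w, p.pos] with x h1 h2 h3
  rw [h1, h2, mul_div_cancel_right₀ _ h3.ne', Real.log_exp]

lemma chart_expMap {p : PosDensity μ} (w : S p) : chart p (expMap p w) = B.rv w.1 := by
  have hE : expect p (logRatio p (expMap p w)) = - K p w.1 := by
    unfold expect
    rw [integral_congr_ae (ae_of_ae p (logRatio_expMap w)),
      integral_sub (integrable_rv _) (integrable_const _)]
    have : ∫ x, B.rv w.1 x ∂p.measure = 0 := expect_rv _
    rw [this]; simp
  refine ext_of_ae p ?_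
  filter_upwards [coe_eTransport p p (logRatio p (expMap p w)), ae_of_ae p (logRatio_expMap w)]
    with x h1 h2
  change eTransport p (logRatio p (expMap p w)) x = _
  rw [h1, h2, hE]; ring

lemma measure_eq_withDensity {p q : PosDensity μ} {f : Ω → ℝ} (hf : AEStronglyMeasurable f μ)
    (h : ∀ᵐ x ∂μ, q.dens x = Real.exp (f x) * p.dens x) :
    q.measure = p.measure.withDensity fun x => ENNReal.ofReal (Real.exp (f x)) := by
  have hp : AEMeasurable (fun x => ENNReal.ofReal (p.dens x)) μ :=
    p.dens.aestronglyMeasurable.aemeasurable.ennreal_ofReal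
  have hf' : AEMeasurable (fun x => ENNReal.ofReal (Real.exp (f x))) μ :=
    (aesm_exp hf).aemeasurable.ennreal_ofReal
  unfold PosDensity.measure
  rw [← withDensity_mul₀ hp hf']
  refine withDensity_congr_ae ?_
  filter_upwards [h] with x hx
  rw [hx, ENNReal.ofReal_mul (Real.exp_pos _).le, Pi.mul_apply, mul_comm]

lemma integrable_withDensity_exp {P : Measure Ω} {f g : Ω → ℝ} (hf : AEStronglyMeasurable f P) :
    Integrable g (P.withDensity fun x => ENNReal.ofReal (Real.exp (f x))) ↔
      Integrable (fun x => Real.exp (f x) * g x) P := by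
  rw [integrable_withDensity_iff_integrable_smul₀' (aesm_exp hf).aemeasurable.ennreal_ofReal
    (Filter.Eventually.of_forall fun _ => ENNReal.ofReal_lt_top)]
  simp only [ENNReal.toReal_ofReal (Real.exp_pos _).le, smul_eq_mul]

lemma integral_withDensity_exp {P : Measure Ω} {f : Ω → ℝ} (hf : AEStronglyMeasurable f P)
    (g : Ω → ℝ) :
    ∫ x, g x ∂P.withDensity (fun x => ENNReal.ofReal (Real.exp (f x))) =
      ∫ x, Real.exp (f x) * g x ∂P := by
  rw [integral_withDensity_eq_integral_toReal_smul₀ (aesm_exp hf).aemeasurable.ennreal_ofReal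
    (Filter.Eventually.of_forall fun _ => ENNReal.ofReal_lt_top)]
  simp only [ENNReal.toReal_ofReal (Real.exp_pos _).le, smul_eq_mul]

lemma aesm_sub_K (p : PosDensity μ) (w : B p) :
    AEStronglyMeasurable (fun x => B.rv w x - K p w) μ :=
  (B.rv w).aestronglyMeasurable.sub aestronglyMeasurable_const

lemma measure_expMap {p : PosDensity μ} (w : S p) :
    (expMap p w).measure =
      p.measure.withDensity fun x => ENNReal.ofReal (Real.exp (B.rv w.1 x - K p w.1)) :=
  measure_eq_withDensity (aesm_sub_K p w.1) (expMap_dens w)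

lemma measure_of_expMap {p : PosDensity μ} (w : S p) :
    p.measure = (expMap p w).measure.withDensity
      fun x => ENNReal.ofReal (Real.exp (-(B.rv w.1 x - K p w.1))) := by
  refine measure_eq_withDensity (aesm_sub_K p w.1).neg ?_
  filter_upwards [expMap_dens w] with x hx
  rw [hx, ← mul_assoc, ← Real.exp_add]
  simp

lemma integrable_expMap {p : PosDensity μ} (w : S p) (g : Ω → ℝ) :
    Integrable g (expMap p w).measure ↔
      Integrable (fun x => Real.exp (B.rv w.1 x) * g x) p.measure := by
  rw [measure_expMap, integrable_withDensity_exp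
    ((aesm_sub_K p w.1).mono_ac p.measure_absolutelyContinuous)]
  have h : (fun x => Real.exp (B.rv w.1 x - K p w.1) * g x)
      = fun x => Real.exp (-K p w.1) * (Real.exp (B.rv w.1 x) * g x) := by
    funext x; rw [sub_eq_add_neg, Real.exp_add]; ring
  rw [h, integrable_const_mul_iff (Real.exp_pos _).ne'.isUnit]

lemma integral_expMap {p : PosDensity μ} (w : S p) (g : Ω → ℝ) :
    ∫ x, g x ∂(expMap p w).measure
      = Real.exp (-K p w.1) * ∫ x, Real.exp (B.rv w.1 x) * g x ∂p.measure := by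
  rw [measure_expMap, integral_withDensity_exp
    ((aesm_sub_K p w.1).mono_ac p.measure_absolutelyContinuous), ← integral_const_mul]
  congr 1
  funext x; rw [sub_eq_add_neg, Real.exp_add]; ring

/-- Openness of `𝒮_p` at `w` and at `0`: on the line through them one can go a little beyond either
point. This is the room needed for an exponent larger than `1` in the norm comparison. -/
lemma exists_scaling_integrable {p : PosDensity μ} {w : B p} (hw : w ∈ S p) :
    ∃ δ : ℝ, 0 < δ ∧ Integrable (fun x => Real.exp ((1 + δ) * B.rv w x)) p.measure ∧
      Integrable (fun x => Real.exp (-δ * B.rv w x)) p.measure := by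
  have hc (g : ℝ → ℝ) (hg : Continuous g) (h0 : g 0 • w ∈ S p) :
      ∀ᶠ δ in nhds (0 : ℝ), g δ • w ∈ S p := by
    have : Continuous fun δ : ℝ => g δ • w := hg.smul continuous_const
    exact this.continuousAt.eventually ((isOpen_S p).mem_nhds h0)
  have h1 := hc (fun δ => 1 + δ) (by fun_prop) (by simpa using hw)
  have h2 := hc (fun δ => -δ) (by fun_prop) (by simpa using zero_mem_S p)
  obtain ⟨δ, ⟨h1, h2⟩, hδ⟩ := (((h1.and h2).filter_mono nhdsWithin_le_nhds).and
    (self_mem_nhdsWithin (a := (0 : ℝ)) (s := Ioi 0))).exists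
  have hi (c : ℝ) (h : c • w ∈ S p) : Integrable (fun x => Real.exp (c * B.rv w x)) p.measure := by
    refine (integrable_exp_of_mem_S h).congr ?_
    filter_upwards [coe_smul' p c (B.rv w)] with x hx
    rw [map_smul, hx]
  exact ⟨δ, hδ, hi _ h1, hi _ h2⟩

/-! ### Domination of Orlicz norms and exponential transport -/

/-- The modular of `q` is controlled by the modular of `p` on its unit ball, up to scaling. -/
def Dominates (p q : PosDensity μ) : Prop :=
  ∃ c C : ℝ, 0 < c ∧ 1 ≤ C ∧ ∀ X : Ω → ℝ, AEStronglyMeasurable X μ →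
    Integrable (fun x => Phi (X x)) p.measure → ∫ x, Phi (X x) ∂p.measure ≤ 1 →
      Integrable (fun x => Phi (c * X x)) q.measure ∧ ∫ x, Phi (c * X x) ∂q.measure ≤ C

/-- Young's inequality with conjugate exponents: convexity of `exp` between `s * a` and `|x|` with
weights `1/s` and `1 - 1/s`. -/
lemma exp_mul_Phi_le {s : ℝ} (hs : 1 < s) (a x : ℝ) :
    Real.exp a * Phi ((1 - s⁻¹) * x) ≤ Real.exp (s * a) + (2 * Phi x + 2) := by
  have hs0 : 0 < s := one_pos.trans hs
  have h1 : s⁻¹ ≤ 1 := inv_le_one_of_one_le₀ hs.le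
  have h2 : 0 < s⁻¹ := inv_pos.2 hs0
  have h := convexOn_exp.2 (mem_univ (s * a)) (mem_univ |x|) h2.le (sub_nonneg.2 h1) (by ring)
  simp only [smul_eq_mul] at h
  rw [inv_mul_cancel_left₀ hs0.ne'] at h
  have h3 : Phi ((1 - s⁻¹) * x) ≤ Real.exp ((1 - s⁻¹) * |x|) := by
    have := Phi_le_exp_abs ((1 - s⁻¹) * x)
    rwa [abs_mul, abs_of_nonneg (sub_nonneg.2 h1)] at this
  calc Real.exp a * Phi ((1 - s⁻¹) * x) ≤ Real.exp a * Real.exp ((1 - s⁻¹) * |x|) := by gcongr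
    _ = Real.exp (a + (1 - s⁻¹) * |x|) := (Real.exp_add _ _).symm
    _ ≤ s⁻¹ * Real.exp (s * a) + (1 - s⁻¹) * Real.exp |x| := h
    _ ≤ 1 * Real.exp (s * a) + 1 * Real.exp |x| := by
        gcongr
        linarith
    _ ≤ _ := by linarith [exp_abs_le x]

lemma dominates_of_withDensity {p q : PosDensity μ} {f : Ω → ℝ} (hf : AEStronglyMeasurable f μ)
    (hq : q.measure = p.measure.withDensity fun x => ENNReal.ofReal (Real.exp (f x)))
    {s : ℝ} (hs : 1 < s) (hi : Integrable (fun x => Real.exp (s * f x)) p.measure) :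
    Dominates p q := by
  have hf' := hf.mono_ac p.measure_absolutelyContinuous
  set A := ∫ x, Real.exp (s * f x) ∂p.measure
  have hA : 0 ≤ A := integral_nonneg fun x => (Real.exp_pos _).le
  -- `A` bounds the first term of `exp_mul_Phi_le`; the `4` is the integral of `2Φ + 2` when `∫ Φ ≤
  -- 1`.
  refine ⟨1 - s⁻¹, A + 4, sub_pos.2 (inv_lt_one_of_one_lt₀ hs), by linarith,
    fun X hX hXi hX1 => ?_⟩
  have hX' := hX.mono_ac p.measure_absolutelyContinuous
  have h2 : Integrable (fun x => 2 * Phi (X x) + 2) p.measure :=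
    (hXi.const_mul 2).add (integrable_const 2)
  have hb : Integrable (fun x => Real.exp (s * f x) + (2 * Phi (X x) + 2)) p.measure :=
    hi.add h2
  have hm : Integrable (fun x => Real.exp (f x) * Phi ((1 - s⁻¹) * X x)) p.measure := by
    refine hb.mono' ((aesm_exp hf').mul (aesm_Phi (hX'.const_mul _)))
      (Filter.Eventually.of_forall fun x => ?_)
    rw [Real.norm_eq_abs, abs_of_nonneg (mul_nonneg (Real.exp_pos _).le (Phi_nonneg _))]
    exact exp_mul_Phi_le hs _ _
  rw [hq]
  refine ⟨(integrable_withDensity_exp hf').2 hm, ?_⟩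
  rw [integral_withDensity_exp hf']
  refine (integral_mono hm hb fun x => exp_mul_Phi_le hs _ _).trans ?_
  rw [integral_add hi h2,
    integral_add (hXi.const_mul 2) (integrable_const 2), integral_const_mul]
  simp only [integral_const, probReal_univ, smul_eq_mul]
  linarith

lemma dominates_expMap {p : PosDensity μ} (w : S p) : Dominates p (expMap p w) := by
  obtain ⟨δ, hδ, h1, -⟩ := exists_scaling_integrable w.2
  refine dominates_of_withDensity (aesm_sub_K p w.1) (measure_expMap w) (s := 1 + δ)
    (by linarith) ?_
  refine (h1.const_mul (Real.exp (-(1 + δ) * K p w.1))).congr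
    (Filter.Eventually.of_forall fun x => ?_)
  change Real.exp _ * Real.exp _ = _
  rw [← Real.exp_add]
  congr 1; ring

/-- The density of `p` with respect to `q` is `e^{-(w - K)}`. Its power `1 + δ`, integrated against
`q`, leaves a multiple of `e^{-δ w}` under `p`, which explains the second integrability of
`exists_scaling_integrable`. -/
lemma dominates_of_expMap {p : PosDensity μ} (w : S p) : Dominates (expMap p w) p := by
  obtain ⟨δ, hδ, -, h1⟩ := exists_scaling_integrable w.2
  refine dominates_of_withDensity (aesm_sub_K p w.1).neg (measure_of_expMap w) (s := 1 + δ)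
    (by linarith) ?_
  rw [integrable_expMap]
  refine (h1.const_mul (Real.exp ((1 + δ) * K p w.1))).congr
    (Filter.Eventually.of_forall fun x => ?_)
  change Real.exp _ * Real.exp _ = Real.exp _ * Real.exp _
  rw [← Real.exp_add, ← Real.exp_add]
  congr 1
  change _ = _ + (1 + δ) * -(B.rv w.1 x - K p w.1)
  ring

lemma Dominates.mem_orlicz {p q : PosDensity μ} (h : Dominates p q) {X : Ω →ₘ[μ] ℝ}
    (hX : X ∈ orlicz Phi p) : X ∈ orlicz Phi q := by
  obtain ⟨c, C, hc, hC, h⟩ := h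
  obtain ⟨α, hα, hi⟩ := (mem_orlicz_iff p X).1 hX
  set M := ∫ x, Phi (α * X x) ∂p.measure
  have hM : 0 ≤ M := integral_nonneg fun x => Phi_nonneg _
  have hM1 : 0 < M + 1 := by linarith
  -- Domination is only assumed on the modular unit ball; dividing by `M + 1` brings `α X` into it.
  have hle (x : Ω) : Phi ((M + 1)⁻¹ * (α * X x)) ≤ (M + 1)⁻¹ * Phi (α * X x) :=
    Phi_smul_le (by positivity) (inv_le_one_of_one_le₀ (by linarith)) _
  have hm : AEStronglyMeasurable (fun x => (M + 1)⁻¹ * (α * X x)) μ :=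
    (X.aestronglyMeasurable.const_mul α).const_mul _
  have hi' : Integrable (fun x => Phi ((M + 1)⁻¹ * (α * X x))) p.measure := by
    refine (hi.const_mul (M + 1)⁻¹).mono' (aesm_Phi (hm.mono_ac p.measure_absolutelyContinuous))
      (Filter.Eventually.of_forall fun x => ?_)
    rw [Real.norm_eq_abs, abs_of_nonneg (Phi_nonneg _)]
    exact hle x
  have h1 := (h _ hm hi' ((integral_mono hi' (hi.const_mul _) hle).trans (by
    rw [integral_const_mul, inv_mul_le_iff₀ hM1]; linarith))).1
  refine (mem_orlicz_iff q X).2 ⟨c * ((M + 1)⁻¹ * α), by positivity, ?_⟩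
  simpa only [mul_assoc] using h1

lemma Dominates.eTransport_mem {p q : PosDensity μ} (h : Dominates p q) (U : B p) :
    eTransport q (B.rv U) ∈ BSub q :=
  eTransport_mem_BSub (h.mem_orlicz (B.rv_mem U).1)

lemma eTransport_add {q : PosDensity μ} {U W : Ω →ₘ[μ] ℝ} (hU : Integrable U q.measure)
    (hW : Integrable W q.measure) : eTransport q (U + W) = eTransport q U + eTransport q W := by
  refine ext_of_ae q ?_
  filter_upwards [coe_eTransport q q (U + W), coe_eTransport q q U, coe_eTransport q q W,
    coe_add' q U W, coe_add' q (eTransport q U) (eTransport q W)] with x h1 h2 h3 h4 h5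
  rw [h1, h5, h2, h3, h4, expect_add hU hW]
  ring

lemma eTransport_smul (q : PosDensity μ) (c : ℝ) (U : Ω →ₘ[μ] ℝ) :
    eTransport q (c • U) = c • eTransport q U := by
  refine ext_of_ae q ?_
  filter_upwards [coe_eTransport q q (c • U), coe_eTransport q q U, coe_smul' q c U,
    coe_smul' q c (eTransport q U)] with x h1 h2 h3 h4
  rw [h1, h4, h2, h3, expect_smul]
  ring

/-- The exponential transport as a linear map. -/
def transportLM {p q : PosDensity μ} (h : Dominates p q) : B p →ₗ[ℝ] B q where
  toFun U := B.mk (eTransport q (B.rv U)) (h.eTransport_mem U)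
  map_add' U W := B.rv_injective (by
    change eTransport q (B.rv (U + W)) = eTransport q (B.rv U) + eTransport q (B.rv W)
    rw [map_add]
    exact eTransport_add (integrable_of_mem_orlicz q (h.mem_orlicz (B.rv_mem U).1))
      (integrable_of_mem_orlicz q (h.mem_orlicz (B.rv_mem W).1)))
  map_smul' c U := B.rv_injective (by
    change eTransport q (B.rv (c • U)) = c • eTransport q (B.rv U)
    rw [map_smul]
    exact eTransport_smul q c _)

lemma exists_bound_of_ball {E F : Type*} [NormedAddCommGroup E] [NormedSpace ℝ E]
    [NormedAddCommGroup F] [NormedSpace ℝ F] (f : E →ₗ[ℝ] F) {M : ℝ}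
    (h : ∀ x, ‖x‖ < 1 → ‖f x‖ ≤ M) : ∃ M', ∀ x, ‖f x‖ ≤ M' * ‖x‖ := by
  refine ⟨2 * M, fun x => ?_⟩
  rcases eq_or_ne x 0 with rfl | hx
  · simp
  have hx' : 0 < ‖x‖ := norm_pos_iff.2 hx
  have h1 := h ((2 * ‖x‖)⁻¹ • x) (by
    rw [norm_smul, norm_inv, Real.norm_eq_abs, abs_of_pos (by positivity)]
    rw [inv_mul_lt_iff₀ (by positivity)]; linarith)
  rw [map_smul, norm_smul, norm_inv, Real.norm_eq_abs, abs_of_pos (by positivity),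
    inv_mul_le_iff₀ (by positivity)] at h1
  linarith

lemma exists_bound_transportLM {p q : PosDensity μ} (h : Dominates p q) :
    ∃ M, ∀ U, ‖transportLM h U‖ ≤ M * ‖U‖ := by
  obtain ⟨c, C, hc, hC, hd⟩ := id h
  -- On the unit ball `cU` has `q`-modular at most `C`, hence mean at most `C + 1` in absolute
  -- value. Midpoint convexity at scale `c / 2` bounds the modular of the centered variable by `(C +
  -- Φ(C + 1)) / 2`.
  refine exists_bound_of_ball _ (M := (C + Phi (C + 1)) / (c / 2)) fun U hU => ?_
  obtain ⟨hi, hle⟩ := integral_Phi_le_one_of_norm_lt_one hU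
  obtain ⟨hi', hle'⟩ := hd _ (B.rv U).aestronglyMeasurable hi hle
  set e := expect q (B.rv U) with he
  have habs : |c * e| ≤ C + 1 := by
    have e1 : c * e = ∫ x, c * B.rv U x ∂q.measure := (integral_const_mul _ _).symm
    rw [e1]
    refine (abs_integral_le_integral_abs).trans ?_
    have hUq := integrable_of_mem_orlicz q (h.mem_orlicz (B.rv_mem U).1)
    calc ∫ x, |c * B.rv U x| ∂q.measure ≤ ∫ x, (Phi (c * B.rv U x) + 1) ∂q.measure :=
          integral_mono (hUq.const_mul c).abs (hi'.add (integrable_const 1)) fun x => abs_le_Phi _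
      _ ≤ C + 1 := by
          rw [integral_add hi' (integrable_const 1)]
          simpa using hle'
  have hPhi : Phi (c * e) ≤ Phi (C + 1) := by
    unfold Phi
    rw [sub_le_sub_iff_right, Real.cosh_le_cosh, abs_of_nonneg (by linarith : 0 ≤ C + 1)]
    exact habs
  have hpt : ∀ᵐ x ∂q.measure, Phi (c / 2 * B.rv (transportLM h U) x) ≤
      1 / 2 * Phi (c * B.rv U x) + 1 / 2 * Phi (c * e) := by
    filter_upwards [coe_eTransport q q (B.rv U)] with x hx
    have h := convexOn_Phi.2 (mem_univ (c * B.rv U x)) (mem_univ (-(c * e)))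
      (by norm_num : (0 : ℝ) ≤ 1 / 2) (by norm_num : (0 : ℝ) ≤ 1 / 2) (by norm_num)
    rw [Phi_neg] at h
    change Phi (c / 2 * eTransport q (B.rv U) x) ≤ _
    rw [hx]
    have e : c / 2 * (B.rv U x - e) = 1 / 2 * (c * B.rv U x) + 1 / 2 * -(c * e) := by ring
    rw [e]
    exact h
  have hb : Integrable (fun x => 1 / 2 * Phi (c * B.rv U x) + 1 / 2 * Phi (c * e)) q.measure :=
    (hi'.const_mul _).add (integrable_const _)
  have hT : Integrable (fun x => Phi (c / 2 * B.rv (transportLM h U) x)) q.measure := by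
    refine hb.mono' (aesm_Phi ((aesm q _).const_mul _)) ?_
    filter_upwards [hpt] with x hx
    rwa [Real.norm_eq_abs, abs_of_nonneg (Phi_nonneg _)]
  refine norm_le_of_integral_Phi _ (by positivity) (by linarith [Phi_nonneg (C + 1)]) hT ?_
  refine (integral_mono_ae hT hb hpt).trans ?_
  rw [integral_add (hi'.const_mul _) (integrable_const _), integral_const_mul]
  simp only [integral_const, probReal_univ, smul_eq_mul]
  linarith [Phi_nonneg (c * e), Phi_nonneg (C + 1)]

/-- The exponential transport as a continuous linear map. -/
def transportL {p q : PosDensity μ} (h : Dominates p q) : B p →L[ℝ] B q :=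
  (transportLM h).mkContinuousOfExistsBound (exists_bound_transportLM h)

lemma rv_transportL {p q : PosDensity μ} (h : Dominates p q) (U : B p) :
    B.rv (transportL h U) = eTransport q (B.rv U) := rfl

lemma transportL_transportL {p q : PosDensity μ} (h : Dominates p q) (h' : Dominates q p)
    (U : B p) : transportL h' (transportL h U) = U := by
  apply B.rv_injective
  rw [rv_transportL, rv_transportL, eTransport_eTransport (integrable_rv U),
    eTransport_eq_self (expect_rv U)]

/-- The exponential transport `B_p → B_q`, `q = e_p(w)`, as a continuous linear equivalence. -/
def transport {p : PosDensity μ} (w : S p) : B p ≃L[ℝ] B (expMap p w) :=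
  ContinuousLinearEquiv.equivOfInverse (transportL (dominates_expMap w))
    (transportL (dominates_of_expMap w)) (transportL_transportL _ _) (transportL_transportL _ _)

lemma rv_transport {p : PosDensity μ} (w : S p) (U : B p) :
    B.rv (transport w U) = eTransport (expMap p w) (B.rv U) := rfl

lemma mem_orlicz_expMap {p : PosDensity μ} (w : S p) {X : Ω →ₘ[μ] ℝ} :
    X ∈ orlicz Phi (expMap p w) ↔ X ∈ orlicz Phi p :=
  ⟨(dominates_of_expMap w).mem_orlicz, (dominates_expMap w).mem_orlicz⟩

/-! ### Change of the base point -/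

lemma mem_finite_iff {p : PosDensity μ} (U : B p) :
    U ∈ {U : B p | ∫⁻ x, ENNReal.ofReal (Real.exp (B.rv U x)) ∂p.measure < ⊤} ↔
      Integrable (fun x => Real.exp (B.rv U x)) p.measure :=
  (integrable_iff_lintegral_ofReal (aesm_exp (aesm p _)) fun _ => (Real.exp_pos _).le).symm

/-- The coordinate change `s_q ∘ e_p : u ↦ T (u - w)` between the charts at `p` and
`q = e_p(w)`. -/
def rebase {p : PosDensity μ} (w : S p) : B p ≃ₜ B (expMap p w) :=
  (Homeomorph.subRight w.1).trans (transport w).toHomeomorph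

lemma rebase_apply {p : PosDensity μ} (w : S p) (u : B p) :
    rebase w u = transport w (u - w.1) := rfl

lemma rebase_self {p : PosDensity μ} (w : S p) : rebase w w.1 = 0 := by
  rw [rebase_apply, sub_self, map_zero]

lemma coe_rebase {p : PosDensity μ} (w : S p) (u : B p) :
    ∀ᵐ x ∂μ, B.rv (rebase w u) x
      = B.rv u x - B.rv w.1 x - expect (expMap p w) (B.rv (u - w.1)) := by
  have h1 := (expMap p w).absolutelyContinuous.ae_le
    (coe_eTransport (expMap p w) (expMap p w) (B.rv (u - w.1)))
  filter_upwards [h1, AEEqFun.coeFn_sub (B.rv u) (B.rv w.1)] with x h1 h2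
  change eTransport (expMap p w) (B.rv (u - w.1)) x = _
  rw [h1, map_sub, h2, Pi.sub_apply]

lemma exp_mul_exp_rebase {p : PosDensity μ} (w : S p) (u : B p) :
    (fun x => Real.exp (B.rv w.1 x) * Real.exp (B.rv (rebase w u) x)) =ᵐ[p.measure]
      fun x => Real.exp (-expect (expMap p w) (B.rv (u - w.1))) * Real.exp (B.rv u x) := by
  filter_upwards [ae_of_ae p (coe_rebase w u)] with x hx
  rw [hx, ← Real.exp_add, ← Real.exp_add]
  congr 1; ring

/-- The product of `e^w` and `e^{rebase w u}` is a constant multiple of `e^u`, so the sets of finite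
exponential moment correspond; a homeomorphism carries interior to interior. -/
lemma rebase_mem_S_iff {p : PosDensity μ} (w : S p) (u : B p) :
    rebase w u ∈ S (expMap p w) ↔ u ∈ S p := by
  have h : {U : B p | ∫⁻ x, ENNReal.ofReal (Real.exp (B.rv U x)) ∂p.measure < ⊤} =
      rebase w ⁻¹' {U | ∫⁻ x, ENNReal.ofReal (Real.exp (B.rv U x)) ∂(expMap p w).measure < ⊤} := by
    ext U
    rw [mem_preimage, mem_finite_iff, mem_finite_iff, integrable_expMap,
      integrable_congr (exp_mul_exp_rebase w U),
      integrable_const_mul_iff (Real.exp_pos _).ne'.isUnit]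
  unfold S
  rw [h, ← Homeomorph.preimage_interior, mem_preimage]

lemma K_rebase {p : PosDensity μ} (w : S p) {u : B p} (hu : u ∈ S p) :
    K (expMap p w) (rebase w u)
      = K p u - K p w.1 - expect (expMap p w) (B.rv (u - w.1)) := by
  apply Real.exp_injective
  rw [exp_K ((rebase_mem_S_iff w u).2 hu), integral_expMap,
    integral_congr_ae (exp_mul_exp_rebase w u), integral_const_mul, ← exp_K hu, ← Real.exp_add,
    ← Real.exp_add]
  congr 1; ring

lemma expMap_rebase {p : PosDensity μ} (w : S p) {u : B p} (hu : u ∈ S p)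
    (hv : rebase w u ∈ S (expMap p w)) :
    expMap (expMap p w) ⟨rebase w u, hv⟩ = expMap p ⟨u, hu⟩ := by
  refine PosDensity.ext_ae ?_
  filter_upwards [expMap_dens (⟨rebase w u, hv⟩ : S (expMap p w)), expMap_dens (⟨u, hu⟩ : S p),
    expMap_dens w, coe_rebase w u] with x h1 h2 h3 h4
  rw [h1, h2, h3, h4, K_rebase w hu, ← mul_assoc, ← Real.exp_add]
  congr 2; ring

lemma maxExp_expMap {p : PosDensity μ} (w : S p) : maxExp (expMap p w) = maxExp p := by
  ext r
  constructor
  · rintro ⟨v, rfl⟩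
    have e := (rebase w).apply_symm_apply v.1
    have hu : (rebase w).symm v.1 ∈ S p := by
      rw [← rebase_mem_S_iff w, e]; exact v.2
    refine ⟨⟨_, hu⟩, ?_⟩
    rw [← expMap_rebase w hu ((rebase_mem_S_iff w _).2 hu)]
    congr 1
    exact Subtype.ext e
  · rintro ⟨u, rfl⟩
    exact ⟨⟨_, (rebase_mem_S_iff w _).2 u.2⟩, expMap_rebase w u.2 _⟩

lemma contDiff_rebase {p : PosDensity μ} (w : S p) {n : WithTop ℕ∞} : ContDiff ℝ n (rebase w) :=
  (transport w).contDiff.comp (contDiff_id.sub contDiff_const)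

lemma contDiff_rebase_symm {p : PosDensity μ} (w : S p) {n : WithTop ℕ∞} :
    ContDiff ℝ n (rebase w).symm :=
  (transport w).symm.contDiff.add contDiff_const

lemma isRegularCurve_expMap {p : PosDensity μ} (w : S p) {I : Set ℝ} {γ : ℝ → PosDensity μ} :
    IsRegularCurve (expMap p w) I γ ↔ IsRegularCurve p I γ := by
  refine and_congr_right fun _ => and_congr_right fun _ => ⟨?_, ?_⟩
  · rintro ⟨U, hU, h⟩
    refine ⟨fun t => (rebase w).symm (U t), (contDiff_rebase_symm w).comp_contDiffOn hU,
      fun t ht => ?_⟩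
    obtain ⟨h1, h2⟩ := h t ht
    have e := (rebase w).apply_symm_apply (U t)
    have hu : (rebase w).symm (U t) ∈ S p := by
      rw [← rebase_mem_S_iff w, e]; exact h1
    refine ⟨hu, ?_⟩
    rw [h2, ← expMap_rebase w hu ((rebase_mem_S_iff w _).2 hu)]
    congr 1
    exact Subtype.ext e.symm
  · rintro ⟨U, hU, h⟩
    refine ⟨fun t => rebase w (U t), (contDiff_rebase w).comp_contDiffOn hU, fun t ht => ?_⟩
    obtain ⟨h1, h2⟩ := h t ht
    exact ⟨(rebase_mem_S_iff w _).2 h1, by rw [expMap_rebase w h1, h2]⟩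

lemma tangentAt_expMap {p : PosDensity μ} (w : S p) (N : Set (PosDensity μ)) (q : PosDensity μ) :
    tangentAt (expMap p w) N q = tangentAt p N q := by
  simp only [tangentAt, isRegularCurve_expMap]

/-! ### Differentiability of expectations and scores -/

/-- Integrable domination of the second-order remainder of `e^{Nk}` times a test variable `y`,
uniform for `k` in the unit ball. -/
lemma abs_exp_sub_one_sub_mul_le {N : ℝ} (h0 : 0 ≤ N) (h1 : N ≤ 1 / 4) (k y : ℝ) :
    |(Real.exp (N * k) - 1 - N * k) * y| ≤ 16 * N ^ 2 * (Real.exp |k| + y ^ 2) := by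
  have e1 : |Real.exp (N * k) - 1 - N * k| ≤ |N * k| ^ 2 * Real.exp |N * k| := by
    have h := Complex.norm_exp_sub_sum_le_norm_mul_exp ((N * k : ℝ) : ℂ) 2
    have e : Complex.exp ((N * k : ℝ) : ℂ) - ∑ m ∈ Finset.range 2, ((N * k : ℝ) : ℂ) ^ m / m.factorial
        = ((Real.exp (N * k) - 1 - N * k : ℝ) : ℂ) := by
      simp [Finset.sum_range_succ, sub_sub]
    rwa [e, Complex.norm_real, Complex.norm_real] at h
  have hk := abs_nonneg k
  have e2 : Real.exp |N * k| ≤ Real.exp (|k| / 4) := by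
    apply Real.exp_le_exp.2
    rw [abs_mul, abs_of_nonneg h0]; nlinarith
  have e3 : k ^ 2 ≤ 32 * Real.exp (|k| / 4) := by
    have := Real.quadratic_le_exp_of_nonneg (div_nonneg hk (by norm_num : (0 : ℝ) ≤ 4))
    nlinarith [sq_abs k]
  -- `e^{|k|}` is split as `z⁴`: one factor `z` bounds the exponential in the remainder, one absorbs
  -- `k² ≤ 32 z`, and `2 z² |y| ≤ z⁴ + y²` does the rest.
  set z := Real.exp (|k| / 4) with hz
  have hz0 : 0 < z := Real.exp_pos _
  have e4 : Real.exp |k| = (z ^ 2) ^ 2 := by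
    rw [hz, ← Real.exp_nat_mul, ← Real.exp_nat_mul]; congr 1; push_cast; ring
  rw [abs_mul]
  calc |Real.exp (N * k) - 1 - N * k| * |y| ≤ (|N * k| ^ 2 * z) * |y| := by
        gcongr
        exact e1.trans (by gcongr)
    _ = N ^ 2 * k ^ 2 * z * |y| := by rw [sq_abs]; ring
    _ ≤ N ^ 2 * (32 * z) * z * |y| := by gcongr
    _ = 16 * N ^ 2 * (2 * z ^ 2 * |y|) := by ring
    _ ≤ 16 * N ^ 2 * ((z ^ 2) ^ 2 + y ^ 2) := by
        gcongr
        nlinarith [sq_nonneg (z ^ 2 - |y|), sq_abs y]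
    _ = _ := by rw [e4]

lemma exists_expect_mulL {q : PosDensity μ} {X : Ω →ₘ[μ] ℝ} (hX : X ∈ orlicz Phi q) :
    ∃ L : B q →L[ℝ] ℝ, ∀ h, L h = expect q (X * B.rv h) := by
  have hi (h : B q) : Integrable (fun x => X x * B.rv h x) q.measure :=
    integrable_mul_of_mem_orlicz hX (B.rv_mem h).1
  let L : B q →ₗ[ℝ] ℝ :=
    { toFun := fun h => expect q (X * B.rv h)
      map_add' := fun h k => by
        rw [expect_mul, expect_mul, expect_mul, ← integral_add (hi h) (hi k)]
        refine integral_congr_ae ?_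
        rw [map_add]
        filter_upwards [coe_add' q (B.rv h) (B.rv k)] with x hx
        rw [hx, mul_add]
      map_smul' := fun c h => by
        rw [expect_mul, expect_mul, RingHom.id_apply, smul_eq_mul, ← integral_const_mul]
        refine integral_congr_ae ?_
        rw [map_smul]
        filter_upwards [coe_smul' q c (B.rv h)] with x hx
        rw [hx]; ring }
  have hb : ∀ h, ‖h‖ < 1 → ‖L h‖ ≤ ∫ x, X x ^ 2 ∂q.measure + 1 := by
    intro h hh
    obtain ⟨hP, hP1⟩ := integral_Phi_le_one_of_norm_lt_one hh
    have hX2 := (memLp_two_of_mem_orlicz hX).integrable_sq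
    change ‖expect q (X * B.rv h)‖ ≤ _
    rw [expect_mul]
    refine (norm_integral_le_integral_norm _).trans ?_
    calc ∫ x, ‖X x * B.rv h x‖ ∂q.measure ≤ ∫ x, (X x ^ 2 + Phi (B.rv h x)) ∂q.measure := by
          refine integral_mono (hi h).norm (hX2.add hP) fun x => ?_
          change ‖X x * B.rv h x‖ ≤ X x ^ 2 + Phi (B.rv h x)
          rw [Real.norm_eq_abs, abs_mul]
          have := sq_half_le_Phi (B.rv h x)
          nlinarith [sq_nonneg (|X x| - |B.rv h x|), sq_abs (X x), sq_abs (B.rv h x),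
            sq_nonneg (X x)]
      _ ≤ _ := by rw [integral_add hX2 hP]; linarith
  exact ⟨L.mkContinuousOfExistsBound (exists_bound_of_ball L hb), fun h => rfl⟩

/-- The remainder is quadratic in the norm: integrate the pointwise bound, using `E[e^{|k|}] ≤ 4` on
the open unit ball and square integrability of `X`. The point `0` is enough, since each density is
the centre of its own chart. -/
lemma hasFDerivAt_integral_exp_mul {q : PosDensity μ} {X : Ω →ₘ[μ] ℝ} (hX : X ∈ orlicz Phi q) :
    ∃ L : B q →L[ℝ] ℝ, (∀ h, L h = expect q (X * B.rv h)) ∧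
      HasFDerivAt (fun u : B q => ∫ x, Real.exp (B.rv u x) * X x ∂q.measure) L 0 := by
  obtain ⟨L, hL⟩ := exists_expect_mulL hX
  refine ⟨L, hL, ?_⟩
  set m := ∫ x, X x ∂q.measure
  set A := ∫ x, X x ^ 2 ∂q.measure
  have hX1 := integrable_of_mem_orlicz q hX
  have hX2 : Integrable (fun x => X x ^ 2) q.measure :=
    (memLp_two_of_mem_orlicz hX).integrable_sq
  have key : ∀ h : B q, ‖h‖ ≤ 1 / 8 →
      ‖(∫ x, Real.exp (B.rv h x) * X x ∂q.measure) - m - L h‖ ≤ 64 * (4 + A) * ‖h‖ ^ 2 := by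
    intro h hh
    have hlin : Integrable (fun x => X x * B.rv h x) q.measure :=
      integrable_mul_of_mem_orlicz hX (B.rv_mem h).1
    -- The factor `2` puts `k` strictly inside the unit ball. It accounts for the radius `1 / 8`,
    -- giving `N ≤ 1 / 4`, and for `64 = 16 · 2²`.
    obtain ⟨k, hk, hhk⟩ : ∃ k : B q, ‖k‖ < 1 ∧ h = (2 * ‖h‖) • k := by
      rcases eq_or_ne h 0 with rfl | h0
      · exact ⟨0, by simp, by simp⟩
      · have hp := norm_pos_iff.2 h0
        refine ⟨(2 * ‖h‖)⁻¹ • h, ?_, ?_⟩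
        · rw [norm_smul, norm_inv, Real.norm_eq_abs, abs_of_pos (by positivity),
            inv_mul_lt_iff₀ (by positivity)]
          linarith
        · rw [smul_smul, mul_inv_cancel₀ (by positivity), one_smul]
    set N := 2 * ‖h‖ with hN
    have hN0 : 0 ≤ N := by positivity
    have hN1 : N ≤ 1 / 4 := by linarith
    obtain ⟨hE, hE4⟩ := integral_exp_abs_le_four hk
    have hrv : ∀ᵐ x ∂q.measure, B.rv h x = N * B.rv k x := by
      rw [hhk, map_smul]
      exact coe_smul' q N (B.rv k)
    have hbd : Integrable (fun x => 16 * N ^ 2 * (Real.exp |B.rv k x| + X x ^ 2)) q.measure :=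
      (hE.add hX2).const_mul _
    have hpt : ∀ᵐ x ∂q.measure, ‖(Real.exp (B.rv h x) - 1 - B.rv h x) * X x‖ ≤
        16 * N ^ 2 * (Real.exp |B.rv k x| + X x ^ 2) := by
      filter_upwards [hrv] with x hx
      rw [hx]
      exact abs_exp_sub_one_sub_mul_le hN0 hN1 _ _
    have hrem : Integrable (fun x => (Real.exp (B.rv h x) - 1 - B.rv h x) * X x) q.measure :=
      hbd.mono' ((((aesm_exp (aesm q _)).sub aestronglyMeasurable_const).sub (aesm q _)).mul
        (aesm q _)) hpt
    have hsum : (∫ x, Real.exp (B.rv h x) * X x ∂q.measure) - m - L h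
        = ∫ x, (Real.exp (B.rv h x) - 1 - B.rv h x) * X x ∂q.measure := by
      rw [hL, expect_mul]
      have : ∫ x, Real.exp (B.rv h x) * X x ∂q.measure = ∫ x,
          ((Real.exp (B.rv h x) - 1 - B.rv h x) * X x + (X x + X x * B.rv h x)) ∂q.measure := by
        congr 1; funext x; ring
      have h2 : Integrable (fun x => X x + X x * B.rv h x) q.measure := hX1.add hlin
      rw [this, integral_add hrem h2, integral_add hX1 hlin]
      ring
    rw [hsum]
    refine (norm_integral_le_of_norm_le hbd hpt).trans ?_
    rw [integral_const_mul, integral_add hE hX2]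
    calc 16 * N ^ 2 * (∫ x, Real.exp |B.rv k x| ∂q.measure + A) ≤ 16 * N ^ 2 * (4 + A) := by
          gcongr
      _ = _ := by rw [hN]; ring
  have hO : (fun h : B q => (∫ x, Real.exp (B.rv h x) * X x ∂q.measure) - m - L h)
      =O[nhds 0] fun h => ‖h - 0‖ ^ 2 := by
    refine Asymptotics.IsBigO.of_bound (64 * (4 + A)) ?_
    filter_upwards [Metric.closedBall_mem_nhds (0 : B q) (by norm_num : (0 : ℝ) < 1 / 8)] with h hh
    rw [sub_zero, norm_pow, norm_norm]
    exact key h (by simpa using hh)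
  have h0 := ((hO.hasFDerivAt (by norm_num)).add L.hasFDerivAt).add_const m
  rw [zero_add] at h0
  refine h0.congr_of_eventuallyEq (Filter.Eventually.of_forall fun h => ?_)
  simp

lemma const_mem_orlicz (q : PosDensity μ) (c : ℝ) :
    (AEEqFun.const Ω c : Ω →ₘ[μ] ℝ) ∈ orlicz Phi q := by
  refine (mem_orlicz_iff q _).2 ⟨1, one_pos, (integrable_const (Phi c)).congr ?_⟩
  filter_upwards [coe_const' q c] with x hx
  rw [hx, one_mul]

/-- The case `X = 1`: the derivative is `h ↦ E_q[h]`, which vanishes on centered variables. -/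
lemma hasFDerivAt_integral_exp (q : PosDensity μ) :
    HasFDerivAt (fun u : B q => ∫ x, Real.exp (B.rv u x) ∂q.measure) (0 : B q →L[ℝ] ℝ) 0 := by
  obtain ⟨L, hL, hd⟩ := hasFDerivAt_integral_exp_mul (const_mem_orlicz q 1)
  have hL0 : L = 0 := by
    ext h
    rw [hL, expect_mul]
    have : ∫ x, (AEEqFun.const Ω (1 : ℝ) : Ω →ₘ[μ] ℝ) x * B.rv h x ∂q.measure
        = ∫ x, B.rv h x ∂q.measure := by
      refine integral_congr_ae ?_
      filter_upwards [coe_const' q 1] with x hx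
      rw [hx, one_mul]
    rw [this]
    exact expect_rv h
  rw [hL0] at hd
  refine hd.congr_of_eventuallyEq (Filter.Eventually.of_forall fun u => ?_)
  refine integral_congr_ae ?_
  filter_upwards [coe_const' q 1] with x hx
  rw [hx, mul_one]

lemma expect_expMap {p : PosDensity μ} (w : S p) (X : Ω →ₘ[μ] ℝ) :
    expect (expMap p w) X = (∫ x, Real.exp (B.rv w.1 x) ∂p.measure)⁻¹ *
      ∫ x, Real.exp (B.rv w.1 x) * X x ∂p.measure := by
  unfold expect
  rw [integral_expMap, Real.exp_neg, exp_K w.2]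

lemma integral_exp_zero (q : PosDensity μ) : ∫ x, Real.exp (B.rv (0 : B q) x) ∂q.measure = 1 := by
  rw [← exp_K (zero_mem_S q), K_zero, Real.exp_zero]

/-- At the centre the normalizing integral equals `1` and has zero derivative, so only the numerator
contributes to the derivative of the quotient. -/
lemma hasDerivAt_expect_of_eq_zero {q : PosDensity μ} {U : ℝ → B q} {U' : B q} {t : ℝ}
    {γ : ℝ → PosDensity μ} (hU : HasDerivAt U U' t) (h0 : U t = 0)
    (hγ : ∀ᶠ s in nhds t, ∃ h : U s ∈ S q, γ s = expMap q ⟨U s, h⟩) {X : Ω →ₘ[μ] ℝ}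
    (hX : X ∈ orlicz Phi q) :
    HasDerivAt (fun s => expect (γ s) X) (expect q (eTransport q X * B.rv U')) t := by
  obtain ⟨L, hL, hd⟩ := hasFDerivAt_integral_exp_mul hX
  have h1 := hasFDerivAt_integral_exp q
  rw [← h0] at hd h1
  have hd' := hd.comp_hasDerivAt t hU
  have h1' := h1.comp_hasDerivAt t hU
  have hne : ∫ x, Real.exp (B.rv (U t) x) ∂q.measure ≠ 0 := by
    rw [h0, integral_exp_zero]; exact one_ne_zero
  have h := (h1'.inv hne).mul hd'
  rw [expect_eTransport_mul hX (B.rv_mem U')]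
  refine (h.congr_of_eventuallyEq ?_).congr_deriv ?_
  · filter_upwards [hγ] with s hs
    obtain ⟨hs, e⟩ := hs
    rw [e, expect_expMap]
    rfl
  · change -(0 : ℝ) / _ * _ + (∫ x, Real.exp (B.rv (U t) x) ∂q.measure)⁻¹ * L U' = _
    rw [h0, integral_exp_zero, hL]
    simp

lemma hasDerivAt_rebase {p : PosDensity μ} (w : S p) {U : ℝ → B p} {U' : B p}
    {t : ℝ} (hU : HasDerivAt U U' t) :
    HasDerivAt (fun s => rebase w (U s)) (transport w U') t := by
  exact ((transport w).hasFDerivAt.comp_hasDerivAt t (hU.sub_const w.1))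

/-- In the chart at `γ t` the curve passes through `0`, and its velocity there is the transport of
`U'`. -/
lemma isScoreAt_of_hasDerivAt {p : PosDensity μ} {U : ℝ → B p} {U' : B p} {t : ℝ}
    {γ : ℝ → PosDensity μ} (hU : HasDerivAt U U' t)
    (hγ : ∀ᶠ s in nhds t, ∃ h : U s ∈ S p, γ s = expMap p ⟨U s, h⟩) :
    IsScoreAt γ t (eTransport (γ t) (B.rv U')) := by
  obtain ⟨ht, et⟩ := hγ.self_of_nhds
  set w : S p := ⟨U t, ht⟩
  unfold IsScoreAt
  rw [et]
  refine ⟨(dominates_expMap w).eTransport_mem U', fun V hV => ?_⟩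
  refine hasDerivAt_expect_of_eq_zero (hasDerivAt_rebase w hU) (rebase_self w) ?_ hV
  filter_upwards [hγ] with s hs
  obtain ⟨hs, e⟩ := hs
  exact ⟨(rebase_mem_S_iff w _).2 hs, by rw [expMap_rebase w hs, e]⟩

lemma eq_zero_of_expect_mul_self {q : PosDensity μ} {W : Ω →ₘ[μ] ℝ} (hW : W ∈ orlicz Phi q)
    (h : expect q (W * W) = 0) : W = 0 := by
  rw [expect_mul, integral_eq_zero_iff_of_nonneg (fun x => mul_self_nonneg _)
    (integrable_mul_of_mem_orlicz hW hW)] at h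
  refine ext_of_ae q ?_
  filter_upwards [h, ae_of_ae q (AEEqFun.coeFn_zero (α := Ω) (β := ℝ) (μ := μ))] with x h1 h2
  rw [h2]
  exact mul_self_eq_zero.1 h1

/-- `W - W'` is itself an admissible test, which makes its square integrate to zero. This gives
uniqueness of scores. -/
lemma eq_of_expect_mul_eq {q : PosDensity μ} {W W' : Ω →ₘ[μ] ℝ} (hW : W ∈ BSub q)
    (hW' : W' ∈ BSub q) (h : ∀ V ∈ BSub q, expect q (V * W) = expect q (V * W')) : W = W' := by
  have hD : W - W' ∈ BSub q := (BSub q).sub_mem hW hW'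
  have hi (V : Ω →ₘ[μ] ℝ) (hV : V ∈ BSub q) : Integrable (fun x => (W - W') x * V x) q.measure :=
    integrable_mul_of_mem_orlicz hD.1 hV.1
  have e := h _ hD
  rw [expect_mul, expect_mul, ← sub_eq_zero, ← integral_sub (hi W hW) (hi W' hW')] at e
  refine sub_eq_zero.1 (eq_zero_of_expect_mul_self hD.1 ?_)
  rw [expect_mul, ← e]
  refine integral_congr_ae ?_
  filter_upwards [coe_sub' q W W'] with x hx
  rw [hx]; ring

lemma IsScoreAt.unique {γ : ℝ → PosDensity μ} {t : ℝ} {W W' : Ω →ₘ[μ] ℝ} (h : IsScoreAt γ t W)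
    (h' : IsScoreAt γ t W') : W = W' := by
  refine eq_of_expect_mul_eq h.1 h'.1 fun V hV => ?_
  have := (h.2 V hV.1).unique (h'.2 V hV.1)
  rwa [expect_eTransport_mul hV.1 h.1, expect_eTransport_mul hV.1 h'.1] at this

/-! ### The derivative of the cumulant functional -/

/-- With `q = e_p(w)`, `K_p(u) = K_q(rebase w u) + K_p(w) + E_q[u - w]`, and `K_q` is stationary at
`0`; only the affine term contributes. -/
lemma hasDerivAt_K {p : PosDensity μ} (w : S p) (V : B p) :
    HasDerivAt (fun s : ℝ => K p (w.1 + s • V)) (expect (expMap p w) (B.rv V)) 0 := by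
  have hline : HasDerivAt (fun s : ℝ => w.1 + s • V) V 0 := by
    simpa using ((hasDerivAt_id (0 : ℝ)).smul_const V).const_add w.1
  have hS : ∀ᶠ s in nhds (0 : ℝ), w.1 + s • V ∈ S p :=
    hline.continuousAt.eventually ((isOpen_S p).mem_nhds (by simp))
  have hr := hasDerivAt_rebase w hline
  have h1 := hasFDerivAt_integral_exp (expMap p w)
  have e0 : rebase w (w.1 + (0 : ℝ) • V) = 0 := by rw [zero_smul, add_zero, rebase_self]
  rw [← e0] at h1
  have hK : HasDerivAt (fun s : ℝ => K (expMap p w) (rebase w (w.1 + s • V))) 0 0 := by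
    have h2 := (h1.comp_hasDerivAt (0 : ℝ) hr).log (by
      change ∫ x, Real.exp (B.rv (rebase w (w.1 + (0 : ℝ) • V)) x) ∂_ ≠ 0
      rw [e0, integral_exp_zero]; exact one_ne_zero)
    exact h2.congr_deriv (by simp)
  have hlin : HasDerivAt (fun s : ℝ => s * expect (expMap p w) (B.rv V) + K p w.1)
      (expect (expMap p w) (B.rv V)) 0 := by
    exact (((hasDerivAt_id (0 : ℝ)).mul_const _).add_const _).congr_deriv (one_mul _)
  have hsum := hK.add hlin
  rw [zero_add] at hsum
  refine hsum.congr_of_eventuallyEq ?_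
  filter_upwards [hS] with s hs
  rw [Pi.add_apply, K_rebase w hs, add_sub_cancel_left, map_smul, expect_smul]
  ring

/-- Both sides are the derivative of `K_p` at `w` along `V`. An equation on the gradient thus
becomes a condition on the means under `e_p(w)`. -/
lemma IsGradK.expect_eq {p : PosDensity μ} {w : B p} {v : Ω →ₘ[μ] ℝ} (h : IsGradK p w v)
    (V : B p) : expect (expMap p ⟨w, h.1⟩) (B.rv V) = expect p (v * B.rv V) := by
  obtain ⟨hw, -, L, hL, hLV⟩ := id h
  have hline : HasDerivAt (fun s : ℝ => w + s • V) V 0 := by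
    simpa using ((hasDerivAt_id (0 : ℝ)).smul_const V).const_add w
  have e0 : w + (0 : ℝ) • V = w := by simp
  rw [← e0] at hL
  have h1 := hL.comp_hasDerivAt (0 : ℝ) hline
  have h2 := hasDerivAt_K ⟨w, hw⟩ V
  rw [← hLV]
  exact h2.unique h1

/-! ### Completeness of the model space -/

/-- `U / (2‖U‖)` lies in the open unit ball and `|x| ≤ Φ(x) + 1`, whence `4 = 2 · 2`. This control
of the `L¹` norm yields almost everywhere convergence of absolutely convergent series. -/
lemma integral_abs_le_norm {p : PosDensity μ} (U : B p) :
    ∫ x, |B.rv U x| ∂p.measure ≤ 4 * ‖U‖ := by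
  rcases eq_or_ne U 0 with rfl | h0
  · have : ∫ x, |B.rv (0 : B p) x| ∂p.measure = ∫ x, (0 : ℝ) ∂p.measure := by
      refine integral_congr_ae ?_
      filter_upwards [ae_of_ae p (coe_zero_rv p)] with x hx
      rw [hx, abs_zero]
    rw [this]; simp
  have hp := norm_pos_iff.2 h0
  have hk : ‖(2 * ‖U‖)⁻¹ • U‖ < 1 := by
    rw [norm_smul, norm_inv, Real.norm_eq_abs, abs_of_pos (by positivity),
      inv_mul_lt_iff₀ (by positivity)]
    linarith
  obtain ⟨hi, hle⟩ := integral_Phi_le_one_of_norm_lt_one hk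
  have h1 : ∫ x, |B.rv ((2 * ‖U‖)⁻¹ • U) x| ∂p.measure ≤ 2 := by
    calc _ ≤ ∫ x, (Phi (B.rv ((2 * ‖U‖)⁻¹ • U) x) + 1) ∂p.measure :=
          integral_mono (integrable_rv _).abs (hi.add (integrable_const 1)) fun x => abs_le_Phi _
      _ ≤ 2 := by
          rw [integral_add hi (integrable_const 1)]
          simp only [integral_const, probReal_univ, smul_eq_mul]
          linarith
  have h2 : ∫ x, |B.rv ((2 * ‖U‖)⁻¹ • U) x| ∂p.measure
      = (2 * ‖U‖)⁻¹ * ∫ x, |B.rv U x| ∂p.measure := by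
    rw [← integral_const_mul, map_smul]
    refine integral_congr_ae ?_
    filter_upwards [coe_smul' p (2 * ‖U‖)⁻¹ (B.rv U)] with x hx
    rw [hx, abs_mul, abs_of_pos (by positivity)]
  rw [h2, inv_mul_le_iff₀ (by positivity)] at h1
  linarith

lemma coe_sum_range (p : PosDensity μ) (u : ℕ → B p) :
    ∀ᵐ x ∂p.measure, ∀ n, B.rv (∑ i ∈ Finset.range n, u i) x
      = ∑ i ∈ Finset.range n, B.rv (u i) x := by
  refine ae_all_iff.2 fun n => ?_
  induction n with
  | zero =>
    filter_upwards [ae_of_ae p (coe_zero_rv p)] with x hx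
    simpa using hx
  | succ n ih =>
    filter_upwards [ih, coe_add' p (B.rv (∑ i ∈ Finset.range n, u i)) (B.rv (u n))] with x h1 h2
    rw [Finset.sum_range_succ, Finset.sum_range_succ, map_add, h2, h1]

lemma ae_summable_of_summable_norm {p : PosDensity μ} {u : ℕ → B p}
    (hu : Summable fun n => ‖u n‖) :
    ∀ᵐ x ∂p.measure, Summable fun n => B.rv (u n) x := by
  have hfin : ∫⁻ x, ∑' n, ‖B.rv (u n) x‖ₑ ∂p.measure ≠ ⊤ := by
    rw [lintegral_tsum fun n => (aesm p _).enorm]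
    have hle (n : ℕ) : ∫⁻ x, ‖B.rv (u n) x‖ₑ ∂p.measure ≤ ENNReal.ofReal (4 * ‖u n‖) := by
      rw [← ofReal_integral_norm_eq_lintegral_enorm (integrable_rv _)]
      exact ENNReal.ofReal_le_ofReal (integral_abs_le_norm _)
    exact ne_top_of_le_ne_top (hu.mul_left 4).tsum_ofReal_ne_top (ENNReal.tsum_le_tsum hle)
  filter_upwards [ae_lt_top' (AEMeasurable.tsum fun n => (aesm p _).enorm) hfin] with x hx
  refine Summable.of_norm ?_
  have := ENNReal.summable_toReal hx.ne
  simpa using this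

/-- Fatou's lemma. -/
lemma modular_le_one_of_tendsto {p : PosDensity μ} {f : ℕ → Ω →ₘ[μ] ℝ} {F : Ω →ₘ[μ] ℝ}
    (hf : ∀ᶠ n in Filter.atTop, modular Phi p (f n) ≤ 1)
    (h : ∀ᵐ x ∂p.measure, Filter.Tendsto (fun n => f n x) Filter.atTop (nhds (F x))) :
    modular Phi p F ≤ 1 := by
  have hm (n : ℕ) : AEMeasurable (fun x => ENNReal.ofReal (Phi (f n x))) p.measure :=
    (aesm_Phi (aesm p _)).aemeasurable.ennreal_ofReal
  calc modular Phi p F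
      = ∫⁻ x, Filter.liminf (fun n => ENNReal.ofReal (Phi (f n x))) Filter.atTop ∂p.measure := by
        refine lintegral_congr_ae ?_
        filter_upwards [h] with x hx
        exact (((ENNReal.continuous_ofReal.comp continuous_Phi).tendsto _).comp hx).liminf_eq.symm
    _ ≤ Filter.liminf (fun n => modular Phi p (f n)) Filter.atTop := lintegral_liminf_le' hm
    _ ≤ 1 := by
        refine Filter.liminf_le_of_frequently_le' hf.frequently

/-- An absolutely convergent series converges almost everywhere to some `F`, by the `L¹` comparison;
Fatou upgrades this to convergence in the Luxemburg norm. Completeness serves the inverse function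
theorem. -/
instance (p : PosDensity μ) : CompleteSpace (B p) := by
  refine NormedAddCommGroup.completeSpace_of_summable_imp_tendsto fun u hu => ?_
  set s : ℕ → B p := fun n => ∑ i ∈ Finset.range n, u i with hs
  have hc : CauchySeq s := cauchySeq_range_of_norm_bounded hu.hasSum.tendsto_sum_nat.cauchySeq
    fun n => le_rfl
  have hlim : ∀ᵐ x ∂p.measure,
      Filter.Tendsto (fun n => B.rv (s n) x) Filter.atTop (nhds (∑' n, B.rv (u n) x)) := by
    filter_upwards [ae_summable_of_summable_norm hu, coe_sum_range p u] with x h1 h2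
    simp only [hs, h2]
    exact h1.hasSum.tendsto_sum_nat
  have hFm : AEStronglyMeasurable (fun x => ∑' n, B.rv (u n) x) μ :=
    aestronglyMeasurable_of_tendsto_ae Filter.atTop (fun n => (B.rv (s n)).aestronglyMeasurable)
      (p.absolutelyContinuous.ae_le hlim)
  set F : Ω →ₘ[μ] ℝ := AEEqFun.mk _ hFm
  have hF : ∀ᵐ x ∂p.measure, F x = ∑' n, B.rv (u n) x := ae_of_ae p (AEEqFun.coeFn_mk _ hFm)
  -- Phrased with the modular because `F` is not yet known to lie in `B p`. Here `n` is fixed and `m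
  -- → ∞` in the Cauchy estimate for `s m - s n`.
  have hmod : ∀ ε : ℝ, 0 < ε → ∃ N, ∀ n ≥ N, modular Phi p (ε⁻¹ • (F - B.rv (s n))) ≤ 1 := by
    intro ε hε
    obtain ⟨N, hN⟩ := Metric.cauchySeq_iff.1 hc ε hε
    refine ⟨N, fun n hn => ?_⟩
    refine modular_le_one_of_tendsto (f := fun m => B.rv (ε⁻¹ • (s m - s n))) ?_ ?_
    · filter_upwards [Filter.eventually_ge_atTop N] with m hm
      have h1 : ‖ε⁻¹ • (s m - s n)‖ < 1 := by
        rw [norm_smul, norm_inv, Real.norm_eq_abs, abs_of_pos hε, inv_mul_lt_iff₀ hε, mul_one,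
          ← dist_eq_norm]
        exact hN m hm n hn
      have := (modular_le_ofReal_iff p _ zero_le_one).2 (integral_Phi_le_one_of_norm_lt_one h1)
      rwa [ENNReal.ofReal_one] at this
    · have hd : ∀ᵐ x ∂p.measure, ∀ m, B.rv (ε⁻¹ • (s m - s n)) x
          = ε⁻¹ * (B.rv (s m) x - B.rv (s n) x) := by
        refine ae_all_iff.2 fun m => ?_
        rw [map_smul, map_sub]
        filter_upwards [coe_smul' p ε⁻¹ (B.rv (s m) - B.rv (s n)),
          coe_sub' p (B.rv (s m)) (B.rv (s n))] with x h1 h2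
        rw [h1, h2]
      filter_upwards [hd, hlim, hF, coe_smul' p ε⁻¹ (F - B.rv (s n)),
        coe_sub' p F (B.rv (s n))] with x h1 h2 h3 h4 h5
      simp only [h1]
      rw [h4, h5, h3]
      exact (h2.sub_const _).const_mul _
  have hint : ∫ x, F x ∂p.measure = 0 := by
    have h1 : HasSum (fun n => ∫ x, B.rv (u n) x ∂p.measure)
        (∫ x, ∑' n, B.rv (u n) x ∂p.measure) :=
      hasSum_integral_of_summable_integral_norm (fun n => integrable_rv (u n))
        (Summable.of_nonneg_of_le (fun n => integral_nonneg fun x => norm_nonneg _)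
          (fun n => integral_abs_le_norm (u n)) (hu.mul_left 4))
    have h2 : (fun n => ∫ x, B.rv (u n) x ∂p.measure) = fun _ => 0 := funext fun n => expect_rv _
    rw [h2] at h1
    rw [integral_congr_ae hF]
    exact h1.unique hasSum_zero
  have hFB : F ∈ BSub p := by
    obtain ⟨N, hN⟩ := hmod 1 one_pos
    have hd : F - B.rv (s N) ∈ BSub p := by
      refine ⟨⟨1⁻¹, by norm_num, (hN N le_rfl).trans_lt ENNReal.one_lt_top⟩, ?_⟩
      have hx := expect_rv (s N)
      unfold expect at hx ⊢
      have hFi : Integrable F p.measure := by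
        have h1 : F - B.rv (s N) ∈ orlicz Phi p :=
          ⟨1⁻¹, by norm_num, (hN N le_rfl).trans_lt ENNReal.one_lt_top⟩
        refine ((integrable_of_mem_orlicz p h1).add (integrable_rv (s N))).congr ?_
        filter_upwards [coe_sub' p F (B.rv (s N))] with x hx
        rw [Pi.add_apply, hx, sub_add_cancel]
      rw [integral_congr_ae (coe_sub' p F (B.rv (s N))), integral_sub hFi (integrable_rv _), hint,
        hx, sub_zero]
    have := (BSub p).add_mem hd (s N).2
    rwa [show F - B.rv (s N) + (s N).1 = F from sub_add_cancel _ _] at this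
  refine ⟨B.mk F hFB, ?_⟩
  rw [Metric.tendsto_atTop]
  intro ε hε
  obtain ⟨N, hN⟩ := hmod (ε / 2) (by positivity)
  refine ⟨N, fun n hn => ?_⟩
  rw [dist_comm, dist_eq_norm]
  have : ‖B.mk F hFB - s n‖ ≤ ε / 2 := by
    refine csInf_le ⟨0, fun a ha => ha.1.le⟩ ⟨by positivity, ?_⟩
    rw [map_sub, B.rv_mk]
    exact hN n hn
  linarith

/-! ### Exponential and mixture families -/

lemma mem_EF_iff {p : PosDensity μ} {V : Submodule ℝ (B p)} (w : S p) :
    expMap p w ∈ EF V ↔ w.1 ∈ V := by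
  change expMap p w ∈ maxExp p ∧ chart p (expMap p w) ∈ asRV V ↔ _
  rw [chart_expMap]
  constructor
  · rintro ⟨-, u, hu, e⟩
    rwa [← B.rv_injective e]
  · exact fun h => ⟨⟨w, rfl⟩, w.1, h, rfl⟩

lemma mem_MF_iff {p : PosDensity μ} {V : Submodule ℝ (B p)} (w : S p) :
    expMap p w ∈ MF V ↔ ∀ U ∈ V, expect (expMap p w) (B.rv U) = 0 :=
  ⟨fun h => h.2, fun h => ⟨⟨w, rfl⟩, h⟩⟩

lemma mem_maxExp_self (p : PosDensity μ) : p ∈ maxExp p :=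
  ⟨⟨0, zero_mem_S p⟩, expMap_zero p _⟩

lemma integrable_rv_expMap {p : PosDensity μ} (w : S p) (U : B p) :
    Integrable (B.rv U) (expMap p w).measure :=
  integrable_of_mem_orlicz _ ((mem_orlicz_expMap w).2 (B.rv_mem U).1)

lemma one_le_exp_K {p : PosDensity μ} {w : B p} (hw : w ∈ S p) : 1 ≤ Real.exp (K p w) := by
  rw [exp_K hw]
  have h1 : ∫ x, (B.rv w x + 1) ∂p.measure = 1 := by
    rw [integral_add (integrable_rv w) (integrable_const 1)]
    have : ∫ x, B.rv w x ∂p.measure = 0 := expect_rv w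
    rw [this]; simp
  rw [← h1]
  exact integral_mono ((integrable_rv w).add (integrable_const 1)) (integrable_exp_of_mem_S hw)
    fun x => Real.add_one_le_exp _

/-- The inequality `e^x ≥ 1 + x`, integrated with `x = w` under `p` and with `x = -w` under
`e_p(w)`, gives `K_p(w) ≥ 0` and `K_p(w) ≤ 0`. With `K_p(w) = 0` the first integrated inequality is
an equality, and strictness off `0` forces `w = 0`. -/
lemma eq_zero_of_expect_expMap_eq_zero {p : PosDensity μ} (w : S p)
    (h : expect (expMap p w) (B.rv w.1) = 0) : w.1 = 0 := by
  have hexp : Integrable (fun x => Real.exp (-B.rv w.1 x)) (expMap p w).measure := by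
    rw [integrable_expMap]
    refine (integrable_const 1).congr (Filter.Eventually.of_forall fun x => ?_)
    change 1 = Real.exp _ * Real.exp _
    rw [← Real.exp_add, add_neg_cancel, Real.exp_zero]
  have hneg : ∫ x, Real.exp (-B.rv w.1 x) ∂(expMap p w).measure = Real.exp (-K p w.1) := by
    rw [integral_expMap]
    have : (fun x => Real.exp (B.rv w.1 x) * Real.exp (-B.rv w.1 x)) = fun _ => 1 := by
      funext x; rw [← Real.exp_add, add_neg_cancel, Real.exp_zero]
    rw [this]; simp
  have hle : 1 ≤ Real.exp (-K p w.1) := by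
    have hq := integrable_rv_expMap w w.1
    have hq' : Integrable (fun x => -B.rv w.1 x) (expMap p w).measure := hq.neg
    have h1 : ∫ x, (-B.rv w.1 x + 1) ∂(expMap p w).measure = 1 := by
      rw [integral_add hq' (integrable_const 1), integral_neg]
      have : ∫ x, B.rv w.1 x ∂(expMap p w).measure = 0 := h
      rw [this]; simp
    rw [← hneg, ← h1]
    exact integral_mono (hq'.add (integrable_const 1)) hexp fun x => Real.add_one_le_exp _
  have hK : K p w.1 = 0 := by
    have h1 := Real.one_le_exp_iff.1 (one_le_exp_K w.2)
    have h2 := Real.one_le_exp_iff.1 hle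
    linarith
  have hi := integrable_rv w.1
  have he := integrable_exp_of_mem_S w.2
  have h0 : ∫ x, (Real.exp (B.rv w.1 x) - (B.rv w.1 x + 1)) ∂p.measure = 0 := by
    have h1 : Integrable (fun x => B.rv w.1 x + 1) p.measure := hi.add (integrable_const 1)
    rw [integral_sub he h1, ← exp_K w.2, hK, integral_add hi (integrable_const 1)]
    have : ∫ x, B.rv w.1 x ∂p.measure = 0 := expect_rv w.1
    rw [this]; simp
  rw [integral_eq_zero_iff_of_nonneg (fun x => sub_nonneg.2 (Real.add_one_le_exp _))
    (he.sub (hi.add (integrable_const 1)))] at h0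
  apply B.rv_injective
  refine ext_of_ae p ?_
  filter_upwards [h0, ae_of_ae p (coe_zero_rv p)] with x h1 h2
  rw [h2]
  by_contra hne
  exact (sub_pos.2 (Real.add_one_lt_exp hne)).ne' h1

lemma EF_inter_MF {p : PosDensity μ} (V : Submodule ℝ (B p)) : EF V ∩ MF V = {p} := by
  ext q
  rw [mem_singleton_iff]
  constructor
  · rintro ⟨hE, hM⟩
    obtain ⟨w, rfl⟩ := hE.1
    have h0 := eq_zero_of_expect_expMap_eq_zero w ((mem_MF_iff w).1 hM _ ((mem_EF_iff w).1 hE))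
    obtain ⟨w, hw⟩ := w
    subst h0
    exact expMap_zero p hw
  · rintro rfl
    have e := expMap_zero q (zero_mem_S q)
    have h0 := (mem_EF_iff ⟨0, zero_mem_S q⟩).2 V.zero_mem
    rw [e] at h0
    exact ⟨h0, mem_maxExp_self q, fun U _ => expect_rv U⟩

/-! ### Tangent spaces -/

lemma mem_tangentAt {p q : PosDensity μ} {N : Set (PosDensity μ)} {U : ℝ → B p} {U' : B p}
    {O : Set ℝ} (hO : IsOpen O) (h0 : (0 : ℝ) ∈ O) (hU : ContDiffOn ℝ 1 U O)
    (hN : ∀ s ∈ O, ∃ h : U s ∈ S p, expMap p ⟨U s, h⟩ ∈ N) (hU' : HasDerivAt U U' 0)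
    (hq : ∀ h : U 0 ∈ S p, expMap p ⟨U 0, h⟩ = q) :
    eTransport q (B.rv U') ∈ tangentAt p N q := by
  classical
  obtain ⟨ε, hε, hball⟩ := Metric.isOpen_iff.1 hO 0 h0
  -- A regular curve must live on an interval, whereas `O` is only open.
  have hsub : Ioo (-ε) ε ⊆ O := by simpa [Real.ball_eq_Ioo] using hball
  -- The default `p` is never taken on `O`.
  let γ : ℝ → PosDensity μ := fun s => if h : U s ∈ S p then expMap p ⟨U s, h⟩ else p
  have hγ : ∀ s ∈ O, ∃ h : U s ∈ S p, γ s = expMap p ⟨U s, h⟩ := fun s hs => by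
    obtain ⟨h, -⟩ := hN s hs
    exact ⟨h, dif_pos h⟩
  have hγ0 : γ 0 = q := by
    obtain ⟨h, e⟩ := hγ 0 h0
    rw [e, hq h]
  refine ⟨Ioo (-ε) ε, γ, 0, ⟨isOpen_Ioo, ordConnected_Ioo, U, hU.mono hsub,
    fun s hs => hγ s (hsub hs)⟩, fun s hs => ?_, by simpa using hε, hγ0, ?_⟩
  · obtain ⟨h, e⟩ := hγ s (hsub hs)
    obtain ⟨h', hN'⟩ := hN s (hsub hs)
    rw [e]; exact hN'
  · have := isScoreAt_of_hasDerivAt hU' (γ := γ) (by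
      filter_upwards [hO.mem_nhds h0] with s hs
      exact hγ s hs)
    rwa [hγ0] at this

lemma IsRegularCurve.exists_score {p : PosDensity μ} {I : Set ℝ} {γ : ℝ → PosDensity μ} {t : ℝ}
    (h : IsRegularCurve p I γ) (ht : t ∈ I) :
    ∃ (U : ℝ → B p) (U' : B p), HasDerivAt U U' t ∧
      (∀ s ∈ I, ∃ h : U s ∈ S p, γ s = expMap p ⟨U s, h⟩) ∧
      IsScoreAt γ t (eTransport (γ t) (B.rv U')) := by
  obtain ⟨hI, -, U, hU, hγ⟩ := h
  have hd : HasDerivAt U (deriv U t) t :=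
    ((hU.contDiffAt (hI.mem_nhds ht)).differentiableAt one_ne_zero).hasDerivAt
  refine ⟨U, deriv U t, hd, hγ, isScoreAt_of_hasDerivAt hd ?_⟩
  filter_upwards [hI.mem_nhds ht] with s hs
  exact hγ s hs

lemma hasDerivAt_mem_of_eventually_mem {E : Type*} [NormedAddCommGroup E] [NormedSpace ℝ E]
    {V : Submodule ℝ E} (hV : IsClosed (V : Set E)) {U : ℝ → E} {U' : E} {t : ℝ}
    (h : HasDerivAt U U' t) (hU : ∀ᶠ s in nhds t, U s ∈ V) : U' ∈ V := by
  refine hV.mem_of_tendsto (hasDerivAt_iff_tendsto_slope.1 h) ?_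
  filter_upwards [hU.filter_mono nhdsWithin_le_nhds] with s hs
  exact V.smul_mem _ (V.sub_mem hs hU.self_of_nhds)

/-- In the chart at `p` the family is an open piece of `V`. Velocities remain in `V` because it is
closed, and the segments `w + s v` realize every direction. -/
lemma tangentAt_EF {p : PosDensity μ} {V : Submodule ℝ (B p)} (hV : IsClosed (V : Set (B p)))
    {q : PosDensity μ} (hq : q ∈ EF V) : tangentAt p (EF V) q = parallel V q := by
  ext W
  constructor
  · rintro ⟨I, γ, t, hγ, hN, ht, rfl, hW⟩
    obtain ⟨U, U', hU, hγU, hsc⟩ := hγ.exists_score ht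
    rw [hW.unique hsc]
    refine ⟨_, ⟨U', ?_, rfl⟩, rfl⟩
    refine hasDerivAt_mem_of_eventually_mem hV hU ?_
    filter_upwards [hγ.1.mem_nhds ht] with s hs
    obtain ⟨h, e⟩ := hγU s hs
    exact (mem_EF_iff ⟨U s, h⟩).1 (e ▸ hN s hs)
  · rintro ⟨_, ⟨v, hv, rfl⟩, rfl⟩
    obtain ⟨w, rfl⟩ := hq.1
    have hw : w.1 ∈ V := (mem_EF_iff w).1 hq
    have hc : ContDiff ℝ 1 fun s : ℝ => w.1 + s • v := by fun_prop
    refine mem_tangentAt (U := fun s => w.1 + s • v)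
      (O := (fun s : ℝ => w.1 + s • v) ⁻¹' S p) ((isOpen_S p).preimage hc.continuous)
      (by simp) hc.contDiffOn (fun s hs => ⟨hs, ?_⟩) ?_ ?_
    · exact (mem_EF_iff ⟨_, hs⟩).2 (V.add_mem hw (V.smul_mem _ hv))
    · simpa using ((hasDerivAt_id (0 : ℝ)).smul_const v).const_add w.1
    · intro h
      congr 1
      exact Subtype.ext (by simp)

lemma parallel_self {p : PosDensity μ} (V : Submodule ℝ (B p)) : parallel V p = asRV V := by
  ext W
  constructor
  · rintro ⟨_, ⟨v, hv, rfl⟩, rfl⟩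
    exact ⟨v, hv, (eTransport_eq_self (expect_rv v)).symm⟩
  · rintro ⟨v, hv, rfl⟩
    exact ⟨_, ⟨v, hv, rfl⟩, eTransport_eq_self (expect_rv v)⟩

/-- Both compare with `y²/2`, since `arsinh v ≤ v` for `v ≥ 0`. Hence scores, which lie in `L^Φ`,
also lie in the pre-dual `L^Ψ`. -/
lemma Psi_le_Phi (y : ℝ) : Psi y ≤ Phi y := by
  refine le_trans ?_ (sq_half_le_Phi y)
  have h : Psi y ≤ ∫ v in (0 : ℝ)..|y|, v := by
    refine intervalIntegral.integral_mono_on (abs_nonneg y)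
      (Real.continuous_arsinh.intervalIntegrable _ _) (continuous_id.intervalIntegrable _ _)
      fun v hv => ?_
    have := Real.self_le_sinh_iff.2 hv.1
    rwa [← Real.arsinh_le_arsinh, Real.arsinh_sinh] at this
  rwa [integral_id, sq_abs, zero_pow two_ne_zero, sub_zero] at h

lemma orliczCentered_Phi_subset_Psi (p : PosDensity μ) :
    orliczCentered Phi p ⊆ orliczCentered Psi p := by
  rintro U ⟨⟨α, hα, h⟩, h0⟩
  exact ⟨⟨α, hα, (lintegral_mono fun x => ENNReal.ofReal_le_ofReal (Psi_le_Phi _)).trans_lt h⟩, h0⟩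

/-- For `U ∈ V` the mean of `U` is zero all along the curve; its derivative, which the score
represents, vanishes too. -/
lemma score_mem_annihilator {p : PosDensity μ} {V : Submodule ℝ (B p)} {I : Set ℝ}
    {γ : ℝ → PosDensity μ} {t : ℝ} (hγ : IsRegularCurve p I γ) (hN : ∀ s ∈ I, γ s ∈ MF V)
    (ht : t ∈ I) {W : Ω →ₘ[μ] ℝ} (hW : IsScoreAt γ t W) :
    W ∈ annihilator (γ t) (parallel V (γ t)) := by
  refine ⟨orliczCentered_Phi_subset_Psi _ hW.1, ?_⟩
  rintro _ ⟨_, ⟨U, hU, rfl⟩, rfl⟩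
  obtain ⟨w, hw⟩ := (hN t ht).1
  have hmem : B.rv U ∈ orlicz Phi (γ t) := by
    rw [← hw]
    exact (mem_orlicz_expMap w).2 (B.rv_mem U).1
  refine (hW.2 _ hmem).unique ((hasDerivAt_const t (0 : ℝ)).congr_of_eventuallyEq ?_)
  filter_upwards [hγ.1.mem_nhds ht] with s hs
  exact (hN s hs).2 U hU

lemma exists_unique_score_MF {p : PosDensity μ} {V : Submodule ℝ (B p)} {I : Set ℝ}
    {γ : ℝ → PosDensity μ} {t : ℝ} (hγ : IsRegularCurve p I γ) (hN : ∀ s ∈ I, γ s ∈ MF V)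
    (ht : t ∈ I) :
    ∃ W ∈ annihilator (γ t) (parallel V (γ t)), ∀ W', IsScoreAt γ t W' ↔ W' = W := by
  obtain ⟨U, U', -, -, hsc⟩ := hγ.exists_score ht
  exact ⟨_, score_mem_annihilator hγ hN ht hsc,
    fun W' => ⟨fun h => h.unique hsc, fun h => h ▸ hsc⟩⟩

/-! ### Sub-manifolds -/

/-- Conjugating the continuous projection by `e` gives a continuous idempotent whose range and
kernel are the two images. -/
lemma isTopCompl_map {E F : Type*} [NormedAddCommGroup E] [NormedSpace ℝ E]
    [NormedAddCommGroup F] [NormedSpace ℝ F] (e : E ≃L[ℝ] F) {V₁ V₂ : Submodule ℝ E}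
    (h : Submodule.IsTopCompl V₁ V₂) :
    Submodule.IsTopCompl (V₁.map (e : E →ₗ[ℝ] F)) (V₂.map (e : E →ₗ[ℝ] F)) := by
  let f : F →L[ℝ] F := (e : E →L[ℝ] F) ∘L V₁.projectionL V₂ h ∘L (e.symm : F →L[ℝ] E)
  have hf (x : F) : f x = e (V₁.projectionL V₂ h (e.symm x)) := rfl
  have hid : IsIdempotentElem f := by
    ext x
    change f (f x) = f x
    rw [hf, hf, e.symm_apply_apply]
    congr 1
    exact Submodule.projectionL_apply_left h (V₁.projectionOntoL V₂ h (e.symm x))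
  have hr : f.range = V₁.map (e : E →ₗ[ℝ] F) := by
    ext y
    constructor
    · rintro ⟨x, rfl⟩
      exact ⟨_, Submodule.projectionL_apply_mem h _, rfl⟩
    · rintro ⟨x, hx, rfl⟩
      refine ⟨e x, ?_⟩
      change f (e x) = e x
      rw [hf, e.symm_apply_apply, Submodule.projectionL_apply_left h ⟨x, hx⟩]
  have hk : f.ker = V₂.map (e : E →ₗ[ℝ] F) := by
    ext y
    rw [LinearMap.mem_ker]
    change f y = 0 ↔ _
    rw [hf, e.map_eq_zero_iff, Submodule.projectionL_apply_eq_zero_iff]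
    constructor
    · exact fun hy => ⟨_, hy, e.apply_symm_apply y⟩
    · rintro ⟨x, hx, rfl⟩
      change e.symm (e x) ∈ V₂
      rwa [e.symm_apply_apply]
  have := ContinuousLinearMap.IsIdempotentElem.isTopCompl hid
  rwa [hr, hk] at this

/-! ### Flattening charts in normed spaces -/

section Flattening

variable {E F : Type*} [NormedAddCommGroup E] [NormedSpace ℝ E] [NormedAddCommGroup F]
  [NormedSpace ℝ F] {V₁ V₂ : Submodule ℝ E}

/-- Product of the restrictions of a linear equivalence to two subspaces. -/
def submoduleMapProd (e : E ≃L[ℝ] F) (V₁ V₂ : Submodule ℝ E) :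
    (V₁ × V₂) ≃L[ℝ] V₁.map (e : E →ₗ[ℝ] F) × V₂.map (e : E →ₗ[ℝ] F) :=
  (e.submoduleMap V₁).prodCongr (e.submoduleMap V₂)

/-- A chart of `E` with values in a product of subspaces, moved to `F` by a homeomorphism, with
values moved by a linear equivalence. -/
def moveChart (σ : OpenPartialHomeomorph E (V₁ × V₂)) (φ : E ≃ₜ F) (e : E ≃L[ℝ] F) :
    OpenPartialHomeomorph F (V₁.map (e : E →ₗ[ℝ] F) × V₂.map (e : E →ₗ[ℝ] F)) :=
  (φ.symm.transOpenPartialHomeomorph σ).transHomeomorph (submoduleMapProd e V₁ V₂).toHomeomorph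

variable (σ : OpenPartialHomeomorph E (V₁ × V₂)) (φ : E ≃ₜ F) (e : E ≃L[ℝ] F)

lemma moveChart_source : (moveChart σ φ e).source = φ.symm ⁻¹' σ.source := rfl

lemma moveChart_target_eq {O₁ : Set V₁} {O₂ : Set V₂} (h : σ.target = O₁ ×ˢ O₂) :
    (moveChart σ φ e).target =
      ((e.submoduleMap V₁).symm ⁻¹' O₁) ×ˢ ((e.submoduleMap V₂).symm ⁻¹' O₂) := by
  change (submoduleMapProd e V₁ V₂).symm ⁻¹' σ.target = _
  rw [h]
  rfl

lemma moveChart_snd_eq_zero_iff (u : E) : (moveChart σ φ e (φ u)).2 = 0 ↔ (σ u).2 = 0 := by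
  change e.submoduleMap V₂ (σ (φ.symm (φ u))).2 = 0 ↔ _
  rw [Homeomorph.symm_apply_apply, ContinuousLinearEquiv.map_eq_zero_iff]

variable {σ φ}

lemma contDiffOn_moveChart (hσ : ContDiffOn ℝ ∞ σ σ.source) (hφ : ContDiff ℝ ∞ φ.symm) :
    ContDiffOn ℝ ∞ (moveChart σ φ e) (moveChart σ φ e).source :=
  (submoduleMapProd e V₁ V₂).contDiff.comp_contDiffOn
    (hσ.comp hφ.contDiffOn fun _ hv => hv)

lemma contDiffOn_moveChart_symm (hσ : ContDiffOn ℝ ∞ σ.symm σ.target) (hφ : ContDiff ℝ ∞ φ) :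
    ContDiffOn ℝ ∞ (moveChart σ φ e).symm (moveChart σ φ e).target :=
  hφ.comp_contDiffOn
    (hσ.comp (submoduleMapProd e V₁ V₂).symm.contDiff.contDiffOn fun _ hy => hy)

/-- `σ` flattens `M` onto the slice `O₁ × {0}` of the product `O₁ × O₂`. -/
structure IsFlattening (M : Set E) (σ : OpenPartialHomeomorph E (V₁ × V₂)) (O₁ : Set V₁)
    (O₂ : Set V₂) : Prop where
  isOpen_left : IsOpen O₁
  isOpen_right : IsOpen O₂
  target_eq : σ.target = O₁ ×ˢ O₂
  contDiffOn : ContDiffOn ℝ ∞ σ σ.source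
  contDiffOn_symm : ContDiffOn ℝ ∞ σ.symm σ.target
  zero_mem : (0 : V₂) ∈ O₂
  mem_iff : ∀ u ∈ σ.source, u ∈ M ↔ (σ u).2 = 0

variable {M : Set E} {O₁ : Set V₁} {O₂ : Set V₂}

lemma IsFlattening.image_eq (h : IsFlattening M σ O₁ O₂) :
    σ '' {u | u ∈ σ.source ∧ u ∈ M} = O₁ ×ˢ {0} := by
  ext y
  constructor
  · rintro ⟨u, ⟨hu, hN⟩, rfl⟩
    have := σ.map_source hu
    rw [h.target_eq] at this
    exact ⟨this.1, (h.mem_iff u hu).1 hN⟩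
  · rintro ⟨hy1, hy2⟩
    have hy2' : y.2 = 0 := hy2
    have hy : y ∈ σ.target := by
      rw [h.target_eq]
      exact ⟨hy1, by rw [hy2']; exact h.zero_mem⟩
    have hs := σ.map_target hy
    refine ⟨σ.symm y, ⟨hs, (h.mem_iff _ hs).2 ?_⟩, σ.right_inv hy⟩
    rw [σ.right_inv hy, hy2']

/-- `φ` moves the points and `e` moves the model subspaces; in use, `φ` is an affine change of chart
and `e` its linear part. -/
lemma IsFlattening.exists_move (h : IsFlattening M σ O₁ O₂) (e : E ≃L[ℝ] F)
    (hV : Submodule.IsTopCompl V₁ V₂)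
    (hφ : ContDiff ℝ ∞ φ) (hφ' : ContDiff ℝ ∞ φ.symm) :
    ∃ V₁' V₂' : Submodule ℝ F, Submodule.IsTopCompl V₁' V₂' ∧
      ∃ (σ' : OpenPartialHomeomorph F (V₁' × V₂')) (O₁' : Set V₁') (O₂' : Set V₂'),
        IsFlattening (φ.symm ⁻¹' M) σ' O₁' O₂' ∧ σ'.source = φ.symm ⁻¹' σ.source := by
  refine ⟨_, _, isTopCompl_map e hV, moveChart σ φ e, _, _,
    ⟨h.isOpen_left.preimage (e.submoduleMap V₁).symm.continuous,
    h.isOpen_right.preimage (e.submoduleMap V₂).symm.continuous,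
    moveChart_target_eq σ φ e h.target_eq, contDiffOn_moveChart e h.contDiffOn hφ',
    contDiffOn_moveChart_symm e h.contDiffOn_symm hφ, ?_, fun v hv => ?_⟩, rfl⟩
  · rw [mem_preimage, map_zero]
    exact h.zero_mem
  · obtain ⟨u, rfl⟩ := φ.surjective v
    rw [moveChart_source, mem_preimage, Homeomorph.symm_apply_apply] at hv
    rw [mem_preimage, Homeomorph.symm_apply_apply, moveChart_snd_eq_zero_iff, h.mem_iff u hv]

/-- The chart is the inverse of the parametrization `G`, after restricting `G` to a product of balls
so that the target of the chart is a product of open sets. -/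
lemma exists_isFlattening (G : OpenPartialHomeomorph (V₁ × V₂) E) {a : V₁} {Q : Set E}
    (ha : (a, 0) ∈ G.source) (hQ : IsOpen Q) (haQ : G (a, 0) ∈ Q)
    (hG : ∀ᶠ x in nhds ((a, 0) : V₁ × V₂), ContDiffAt ℝ ∞ G x ∧ ContDiffAt ℝ ∞ G.symm (G x) ∧
      (G x ∈ Q → (G x ∈ M ↔ x.2 = 0))) :
    ∃ (σ : OpenPartialHomeomorph E (V₁ × V₂)) (O₁ : Set V₁) (O₂ : Set V₂),
      IsFlattening M σ O₁ O₂ ∧ σ.source ⊆ Q ∧ G (a, 0) ∈ σ.source := by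
  have hs : ∀ᶠ x in nhds ((a, 0) : V₁ × V₂), x ∈ G.source := G.open_source.mem_nhds ha
  have hall := hG.and (hs.and ((G.continuousAt ha).eventually (hQ.mem_nhds haQ)))
  obtain ⟨r, hr, hball⟩ := Metric.eventually_nhds_iff_ball.1 hall
  -- With the sup metric a ball of the product is a product of balls.
  rw [← ball_prod_same] at hball
  set P : Set (V₁ × V₂) := Metric.ball a r ×ˢ Metric.ball 0 r
  have hP : IsOpen P := Metric.isOpen_ball.prod Metric.isOpen_ball
  have hsrc : (G.restrOpen P hP).source = P := by
    rw [OpenPartialHomeomorph.restrOpen_source]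
    exact inter_eq_right.2 fun x hx => (hball x hx).2.1
  have himg : ∀ u ∈ (G.restrOpen P hP).symm.source, ∃ x ∈ P, G x = u ∧ G.symm u = x := by
    intro u hu
    have h1 := (G.restrOpen P hP).map_target hu
    have h2 := (G.restrOpen P hP).right_inv hu
    rw [hsrc] at h1
    exact ⟨_, h1, h2, rfl⟩
  refine ⟨(G.restrOpen P hP).symm, Metric.ball a r, Metric.ball 0 r,
    ⟨Metric.isOpen_ball, Metric.isOpen_ball, hsrc, ?_, ?_, Metric.mem_ball_self hr, ?_⟩, ?_, ?_⟩
  · intro u hu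
    obtain ⟨x, hx, rfl, -⟩ := himg u hu
    exact (hball x hx).1.2.1.contDiffWithinAt
  · intro x hx
    have hx' : x ∈ P := by rw [← hsrc]; exact hx
    exact (hball x hx').1.1.contDiffWithinAt
  · intro u hu
    obtain ⟨x, hx, rfl, e⟩ := himg u hu
    rw [(hball x hx).1.2.2 (hball x hx).2.2]
    change _ ↔ (G.symm (G x)).2 = 0
    rw [e]
  · intro u hu
    obtain ⟨x, hx, rfl, -⟩ := himg u hu
    exact (hball x hx).2.2
  · refine (G.restrOpen P hP).map_source (x := (a, 0)) ?_
    rw [hsrc]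
    exact ⟨Metric.mem_ball_self hr, Metric.mem_ball_self hr⟩

lemma exists_isFlattening_submodule (h : Submodule.IsTopCompl V₁ V₂) {Q : Set E} (hQ : IsOpen Q)
    {a : E} (ha : a ∈ V₁) (haQ : a ∈ Q) (hM : ∀ u ∈ Q, u ∈ M ↔ u ∈ V₁) :
    ∃ (σ : OpenPartialHomeomorph E (V₁ × V₂)) (O₁ : Set V₁) (O₂ : Set V₂),
      IsFlattening M σ O₁ O₂ ∧ σ.source ⊆ Q ∧ a ∈ σ.source := by
  set T := Submodule.prodEquivOfIsTopCompl V₁ V₂ h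
  have hT (x : V₁ × V₂) : T x = (x.1 : E) + x.2 := rfl
  have hT0 : T (⟨a, ha⟩, 0) = a := by rw [hT]; simp
  have key := exists_isFlattening (M := M) T.toHomeomorph.toOpenPartialHomeomorph
    (a := ⟨a, ha⟩) (mem_univ _) hQ (by change T _ ∈ _; rwa [hT0])
    (Filter.Eventually.of_forall fun x => ⟨T.contDiff.contDiffAt, T.symm.contDiff.contDiffAt,
      fun hS => by
        rw [hM _ hS]
        change T x ∈ V₁ ↔ _
        rw [hT, V₁.add_mem_iff_right x.1.2]
        constructor
        · intro hx
          exact Subtype.ext (Submodule.disjoint_def.1 h.isCompl.disjoint _ hx x.2.2)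
        · intro hx
          rw [hx]; exact V₁.zero_mem⟩)
  change ∃ σ O₁ O₂, IsFlattening M σ O₁ O₂ ∧ σ.source ⊆ Q ∧ T (⟨a, ha⟩, 0) ∈ σ.source at key
  rwa [hT0] at key

lemma exists_isFlattening_of_hasFDerivAt [CompleteSpace V₁] [CompleteSpace V₂]
    (h : Submodule.IsTopCompl V₁ V₂) {f : V₁ × V₂ → E} {P : Set (V₁ × V₂)} {Q : Set E}
    (hP : IsOpen P) (h0 : (0 : V₁ × V₂) ∈ P) (hf : ContDiffOn ℝ ∞ f P)
    (hf' : HasFDerivAt f (Submodule.prodEquivOfIsTopCompl V₁ V₂ h : (V₁ × V₂) →L[ℝ] E) 0)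
    (hQ : IsOpen Q) (hfQ : f 0 ∈ Q) (hM : ∀ x ∈ P, f x ∈ Q → (f x ∈ M ↔ x.2 = 0)) :
    ∃ (σ : OpenPartialHomeomorph E (V₁ × V₂)) (O₁ : Set V₁) (O₂ : Set V₂),
      IsFlattening M σ O₁ O₂ ∧ σ.source ⊆ Q ∧ f 0 ∈ σ.source := by
  have hfc : ∀ x ∈ P, ContDiffAt ℝ ∞ f x := fun x hx => hf.contDiffAt (hP.mem_nhds hx)
  have hfc0 := hfc _ h0
  have hn : (∞ : WithTop ℕ∞) ≠ 0 := by simp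
  set G := hfc0.toOpenPartialHomeomorph f hf' hn
  have hGf : (G : V₁ × V₂ → E) = f := rfl
  have hsrc : 0 ∈ G.source := hfc0.mem_toOpenPartialHomeomorph_source hf' hn
  -- Smoothness of the inverse at nearby points needs an invertible derivative there; invertibility
  -- is an open condition and `fderiv ℝ f` is continuous at `0`.
  have hinv : ∀ᶠ x in nhds (0 : V₁ × V₂),
      fderiv ℝ f x ∈ range ((↑) : ((V₁ × V₂) ≃L[ℝ] E) → (V₁ × V₂) →L[ℝ] E) := by
    have hc : ContinuousAt (fderiv ℝ f) 0 := (hfc0.fderiv_right (m := 0) (by simp)).continuousAt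
    refine hc.eventually (ContinuousLinearEquiv.isOpen.mem_nhds ?_)
    rw [hf'.fderiv]
    exact ⟨_, rfl⟩
  refine exists_isFlattening G (a := 0) hsrc hQ hfQ ?_
  have hPn : ∀ᶠ x in nhds (0 : V₁ × V₂), x ∈ P := hP.mem_nhds h0
  have hGn : ∀ᶠ x in nhds (0 : V₁ × V₂), x ∈ G.source := G.open_source.mem_nhds hsrc
  change ∀ᶠ x in nhds (0 : V₁ × V₂), _
  filter_upwards [hinv, hPn, hGn] with x ⟨e, he⟩ hxP hxs
  refine ⟨hfc x hxP, ?_, hM x hxP⟩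
  refine G.contDiffAt_symm (f₀' := e) (G.map_source hxs) ?_ ?_
  · rw [G.left_inv hxs, he, hGf]
    exact ((hfc x hxP).differentiableAt (by simp)).hasFDerivAt
  · rw [G.left_inv hxs, hGf]
    exact hfc x hxP

end Flattening

/-- The set `N` in the chart at `p`. -/
def coords (p : PosDensity μ) (N : Set (PosDensity μ)) : Set (B p) :=
  {u | ∃ h : u ∈ S p, expMap p ⟨u, h⟩ ∈ N}

lemma mem_coords_iff {p : PosDensity μ} {N : Set (PosDensity μ)} {u : B p} (h : u ∈ S p) :
    u ∈ coords p N ↔ expMap p ⟨u, h⟩ ∈ N := ⟨fun h => h.2, fun h' => ⟨h, h'⟩⟩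

lemma coords_expMap {p : PosDensity μ} (w : S p) (N : Set (PosDensity μ)) :
    coords (expMap p w) N = (rebase w).symm ⁻¹' coords p N := by
  ext v
  obtain ⟨u, rfl⟩ := (rebase w).surjective v
  rw [mem_preimage, Homeomorph.symm_apply_apply]
  constructor
  · rintro ⟨h, hN⟩
    have hu := (rebase_mem_S_iff w u).1 h
    rw [expMap_rebase w hu h] at hN
    exact ⟨hu, hN⟩
  · rintro ⟨h, hN⟩
    have hv := (rebase_mem_S_iff w u).2 h
    rw [← expMap_rebase w h hv] at hN
    exact ⟨hv, hN⟩

section Submanifold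

variable {p : PosDensity μ} {N : Set (PosDensity μ)} {V₁ V₂ : Submodule ℝ (B p)}
  {σ : OpenPartialHomeomorph (B p) (V₁ × V₂)} {O₁ : Set V₁} {O₂ : Set V₂}

lemma IsFlattening.hasSplittingChartAt (h : IsFlattening (coords p N) σ O₁ O₂)
    (hS : σ.source ⊆ S p) (h0 : 0 ∈ σ.source) : HasSplittingChartAt N p V₁ V₂ :=
  ⟨σ, O₁, O₂, h0, hS, h.isOpen_left, h.isOpen_right, h.target_eq, h.contDiffOn,
    h.contDiffOn_symm, h.image_eq⟩

lemma IsFlattening.exists_hasSplittingChartAt_of_homeomorph {q : PosDensity μ}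
    (h : IsFlattening (coords p N) σ O₁ O₂) (hV : Submodule.IsTopCompl V₁ V₂)
    (hS : σ.source ⊆ S p) (e : B p ≃L[ℝ] B q) {φ : B p ≃ₜ B q} (hφ : ContDiff ℝ ∞ φ)
    (hφ' : ContDiff ℝ ∞ φ.symm) (hφS : φ.symm ⁻¹' S p ⊆ S q)
    (hφN : coords q N = φ.symm ⁻¹' coords p N) (h0 : φ.symm 0 ∈ σ.source) :
    ∃ V₁' V₂' : Submodule ℝ (B q), Submodule.IsTopCompl V₁' V₂' ∧
      HasSplittingChartAt N q V₁' V₂' := by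
  obtain ⟨V₁', V₂', hV', σ', O₁', O₂', h', hs⟩ := h.exists_move e hV hφ hφ'
  rw [← hφN] at h'
  exact ⟨V₁', V₂', hV', h'.hasSplittingChartAt
    (hs.subset.trans ((preimage_mono hS).trans hφS)) (hs.symm.subset (mem_preimage.2 h0))⟩

/-- Sub-manifold charts are required at every point of `N`, each in its own fibre. One flattening at
`p` serves all points of its source, the change of chart being affine. -/
lemma IsFlattening.exists_hasSplittingChartAt (h : IsFlattening (coords p N) σ O₁ O₂)
    (hV : Submodule.IsTopCompl V₁ V₂) (hS : σ.source ⊆ S p) (w : S p) (hw : w.1 ∈ σ.source) :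
    ∃ V₁' V₂' : Submodule ℝ (B (expMap p w)),
      Submodule.IsTopCompl V₁' V₂' ∧ HasSplittingChartAt N (expMap p w) V₁' V₂' := by
  have h0 : (rebase w).symm 0 = w.1 := by rw [← rebase_self w, Homeomorph.symm_apply_apply]
  have hsub : (rebase w).symm ⁻¹' S p ⊆ S (expMap p w) := fun v hv => by
    rw [← (rebase w).apply_symm_apply v, rebase_mem_S_iff]
    exact mem_preimage.1 hv
  rw [← h0] at hw
  exact h.exists_hasSplittingChartAt_of_homeomorph hV hS (transport w) (contDiff_rebase w)
    (contDiff_rebase_symm w) hsub (coords_expMap w N) hw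

lemma isSubmanifold_EF (h : Submodule.IsTopCompl V₁ V₂) : IsSubmanifold p (EF V₁) := by
  refine ⟨fun q hq => hq.1, fun q hq => ?_⟩
  obtain ⟨w, rfl⟩ := hq.1
  obtain ⟨σ, O₁, O₂, hσ, hS, hw⟩ := exists_isFlattening_submodule (M := coords p (EF V₁)) h
    (isOpen_S p) ((mem_EF_iff w).1 hq) w.2
    fun u hu => (mem_coords_iff hu).trans (mem_EF_iff ⟨u, hu⟩)
  exact hσ.exists_hasSplittingChartAt h hS w hw

lemma IsFlattening.isSubmanifold (h : IsFlattening (coords p N) σ O₁ O₂)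
    (hV : Submodule.IsTopCompl V₁ V₂) (hS : σ.source ⊆ S p) :
    IsSubmanifold p (N ∩ expMap p '' (Subtype.val ⁻¹' σ.source)) := by
  have h' : IsFlattening (coords p (N ∩ expMap p '' (Subtype.val ⁻¹' σ.source))) σ O₁ O₂ :=
    { h with
      mem_iff := fun u hu => by
        rw [← h.mem_iff u hu, mem_coords_iff (hS hu), mem_coords_iff (hS hu)]
        exact and_iff_left ⟨⟨u, hS hu⟩, hu, rfl⟩ }
  constructor
  · rintro _ ⟨-, w, -, rfl⟩
    exact ⟨w, rfl⟩
  · rintro _ ⟨-, w, hw, rfl⟩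
    exact h'.exists_hasSplittingChartAt hV hS w hw

end Submanifold

/-! ### The mixture family under the mixed diffeomorphism assumption -/

/-- Moving a point of `MF V` in a direction of `V` leaves `MF V`. -/
lemma expMap_add_mem_MF_iff {p : PosDensity μ} {V : Submodule ℝ (B p)} (w : S p)
    (hw : expMap p w ∈ MF V) {a : B p} (ha : a ∈ V) (hS : a + w.1 ∈ S p) :
    expMap p ⟨a + w.1, hS⟩ ∈ MF V ↔ a = 0 := by
  constructor
  · intro h
    have hS' := (rebase_mem_S_iff w (a + w.1)).2 hS
    have e : rebase w (a + w.1) = transport w a := by rw [rebase_apply, add_sub_cancel_right]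
    have h1 := (mem_MF_iff w).1 hw a ha
    have h2 := (mem_MF_iff _).1 h a ha
    -- Seen from `e_p(w)`, the second point has coordinate `T a`. The means of `a` vanish under both
    -- densities, so `T a` has zero mean at the second point and must be zero.
    have h3 : expect (expMap (expMap p w) ⟨rebase w (a + w.1), hS'⟩)
        (B.rv (rebase w (a + w.1))) = 0 := by
      rw [expMap_rebase w hS hS', e, rv_transport, eTransport,
        expect_sub_const (integrable_rv_expMap _ a), h1, h2, sub_zero]
    have h4 := eq_zero_of_expect_expMap_eq_zero ⟨_, hS'⟩ h3
    change rebase w (a + w.1) = 0 at h4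
    rwa [e, ContinuousLinearEquiv.map_eq_zero_iff] at h4
  · rintro rfl
    have : (⟨0 + w.1, hS⟩ : S p) = w := Subtype.ext (zero_add _)
    rwa [this]

/-- Split a score as `a + b` along `V ⊕ V₂`. Both the score and `b` are orthogonal to `a`, so
`E_p[a²] = 0`. -/
lemma tangentAt_MF_subset {p : PosDensity μ} {V V₂ : Submodule ℝ (B p)} (h : IsCompl V V₂)
    (horth : asRV V₂ ⊆ annihilator p (asRV V)) : tangentAt p (MF V) p ⊆ asRV V₂ := by
  rintro W ⟨I, γ, t, hγ, hN, ht, e, hW⟩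
  have hann := score_mem_annihilator hγ hN ht hW
  have hWB := hW.1
  rw [e] at hann hWB
  rw [parallel_self] at hann
  obtain ⟨a, ha, b, hb, hab⟩ := Submodule.mem_sup.1
    (h.sup_eq_top ▸ Submodule.mem_top (x := B.mk W hWB))
  have hrv : W = B.rv a + B.rv b := by rw [← map_add, hab, B.rv_mk]
  have e1 := hann.2 _ ⟨a, ha, rfl⟩
  have e2 := (horth ⟨b, hb, rfl⟩).2 _ ⟨a, ha, rfl⟩
  have h0 : expect p (B.rv a * B.rv a) = 0 := by
    have hia (c : B p) : Integrable (fun x => B.rv a x * B.rv c x) p.measure :=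
      integrable_mul_of_mem_orlicz (B.rv_mem a).1 (B.rv_mem c).1
    rw [hrv, expect_mul] at e1
    rw [expect_mul] at e2 ⊢
    have : ∫ x, B.rv a x * (B.rv a + B.rv b) x ∂p.measure
        = ∫ x, (B.rv a x * B.rv a x + B.rv a x * B.rv b x) ∂p.measure := by
      refine integral_congr_ae ?_
      filter_upwards [coe_add' p (B.rv a) (B.rv b)] with x hx
      rw [hx, mul_add]
    rw [this, integral_add (hia a) (hia b), e2, add_zero] at e1
    exact e1
  have ha0 := eq_zero_of_expect_mul_self (B.rv_mem a).1 h0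
  exact ⟨b, hb, by rw [hrv, ha0, zero_add]⟩

section MixedDiffeo

variable {p : PosDensity μ} {V V₂ : Submodule ℝ (B p)} {O : Set (B p)} {H : B p → B p}

lemma expMap_mem_MF_of_isGradK (horth : asRV V₂ ⊆ annihilator p (asRV V)) {w b : B p}
    (hb : b ∈ V₂) (h : IsGradK p w (B.rv b)) : expMap p ⟨w, h.1⟩ ∈ MF V := by
  rw [mem_MF_iff]
  intro U hU
  rw [h.expect_eq U, mul_comm]
  exact (horth ⟨b, hb, rfl⟩).2 _ ⟨U, hU, rfl⟩

/-- A zero gradient at `w` makes the mean of `w` under `e_p(w)` zero. -/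
lemma eq_zero_of_isGradK_zero {w : B p} (h : IsGradK p w (B.rv (0 : B p))) : w = 0 := by
  refine eq_zero_of_expect_expMap_eq_zero ⟨w, h.1⟩ ?_
  rw [h.expect_eq, expect_mul]
  have : ∫ x, B.rv (0 : B p) x * B.rv w x ∂p.measure = ∫ x, (0 : ℝ) ∂p.measure := by
    refine integral_congr_ae ?_
    filter_upwards [ae_of_ae p (coe_zero_rv p)] with x hx
    rw [hx, zero_mul]
  rw [this, integral_zero]

/-- A local section of `∇K_p` along `V₂` is tangent to the inclusion at `0`. -/
lemma fderiv_gradK_section (hO : IsOpen O) (h0 : (0 : B p) ∈ O)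
    (hH : ∀ b ∈ V₂, b ∈ O → IsGradK p (H b) (B.rv b)) {H' : B p →L[ℝ] B p}
    (hd : HasFDerivAt H H' 0) {b : B p} (hb : b ∈ V₂) : H' b = b := by
  have hline : HasDerivAt (fun s : ℝ => s • b) b 0 := by
    simpa using (hasDerivAt_id (0 : ℝ)).smul_const b
  have hsO : ∀ᶠ s in nhds (0 : ℝ), s • b ∈ O :=
    hline.continuousAt.eventually (hO.mem_nhds (by simpa using h0))
  have e0 : (0 : ℝ) • b = 0 := zero_smul ℝ b
  rw [← e0] at hd
  have hHd : HasDerivAt (fun s : ℝ => H (s • b)) (H' b) 0 := hd.comp_hasDerivAt (0 : ℝ) hline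
  have hgrad (s : ℝ) (hs : s • b ∈ O) := hH _ (V₂.smul_mem s hb) hs
  have hH0 : H ((0 : ℝ) • b) = 0 := by
    have := hgrad 0 hsO.self_of_nhds
    rw [e0] at this ⊢
    exact eq_zero_of_isGradK_zero this
  apply B.rv_injective
  refine eq_of_expect_mul_eq (B.rv_mem _) (B.rv_mem _) fun X hX => ?_
  classical
  let γ : ℝ → PosDensity μ := fun s => if h : H (s • b) ∈ S p then expMap p ⟨_, h⟩ else p
  have hγ : ∀ᶠ s in nhds (0 : ℝ), ∃ h : H (s • b) ∈ S p, γ s = expMap p ⟨_, h⟩ := by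
    filter_upwards [hsO] with s hs
    exact ⟨(hgrad s hs).1, dif_pos _⟩
  -- The mean of `X` along `e_p(H(s b))` is differentiated twice over: through the chart it has
  -- derivative `E_p[X · H' b]`, and by the gradient equation it equals `s E_p[X b]`.
  have hd1 := hasDerivAt_expect_of_eq_zero hHd hH0 hγ (X := X) hX.1
  rw [expect_eTransport_mul hX.1 (B.rv_mem _)] at hd1
  refine hd1.unique ?_
  have hd2 : HasDerivAt (fun s : ℝ => s * expect p (X * B.rv b)) (expect p (X * B.rv b)) 0 := by
    simpa using (hasDerivAt_id (0 : ℝ)).mul_const (expect p (X * B.rv b))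
  refine hd2.congr_of_eventuallyEq ?_
  filter_upwards [hsO, hγ] with s hs hγs
  obtain ⟨h, e⟩ := hγs
  have := (hgrad s hs).expect_eq (B.mk X hX)
  rw [B.rv_mk] at this
  rw [e, this, mul_comm, expect_mul, expect_mul, ← integral_const_mul, map_smul]
  refine integral_congr_ae ?_
  filter_upwards [coe_smul' p s (B.rv b)] with x hx
  rw [hx]; ring

/-- The curve `s ↦ e_p(H(s b))` stays in the mixture family and has velocity `b` at `0`. -/
lemma subset_tangentAt_MF (horth : asRV V₂ ⊆ annihilator p (asRV V)) (hO : IsOpen O)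
    (h0 : (0 : B p) ∈ O) (hH : ∀ b ∈ V₂, b ∈ O → IsGradK p (H b) (B.rv b))
    (hHc : ContDiffOn ℝ ∞ H O) : asRV V₂ ⊆ tangentAt p (MF V) p := by
  rintro _ ⟨b, hb, rfl⟩
  have hd : HasFDerivAt H (fderiv ℝ H 0) 0 :=
    ((hHc.contDiffAt (hO.mem_nhds h0)).differentiableAt (by simp)).hasFDerivAt
  have hb' := fderiv_gradK_section hO h0 hH hd hb
  have hline : HasDerivAt (fun s : ℝ => s • b) b 0 := by
    simpa using (hasDerivAt_id (0 : ℝ)).smul_const b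
  have hlc : ContDiff ℝ 1 fun s : ℝ => s • b := by fun_prop
  have e0 : (0 : ℝ) • b = 0 := zero_smul ℝ b
  have hHd : HasDerivAt (fun s : ℝ => H (s • b)) b 0 := by
    rw [← e0] at hd
    exact (hd.comp_hasDerivAt (0 : ℝ) hline).congr_deriv (by rw [e0]; exact hb')
  rw [← eTransport_eq_self (expect_rv b)]
  refine mem_tangentAt (U := fun s => H (s • b)) (O := (fun s : ℝ => s • b) ⁻¹' O)
    (hO.preimage hlc.continuous) (by simpa using h0)
    ((hHc.of_le (by norm_cast)).comp hlc.contDiffOn fun _ hs => hs) (fun s hs => ?_) hHd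
    (fun hS => ?_)
  · have hg := hH _ (V₂.smul_mem s hb) hs
    exact ⟨hg.1, expMap_mem_MF_of_isGradK horth (V₂.smul_mem s hb) hg⟩
  · have hg := hH 0 V₂.zero_mem h0
    have hz := eq_zero_of_isGradK_zero hg
    have : (⟨H ((0 : ℝ) • b), hS⟩ : S p) = ⟨0, zero_mem_S p⟩ := Subtype.ext (by
      change H ((0 : ℝ) • b) = 0
      rw [e0, hz])
    rw [this, expMap_zero]

/-- The parametrization is `f(b, a) = a + H(b)`: its derivative at `0` is the sum map of the
splitting, and `e_p(f(b, a))` is in the family iff `a = 0`. The factor `V₂` comes first because the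
family is modelled on it. -/
lemma exists_isFlattening_MF (h : Submodule.IsTopCompl V V₂)
    (horth : asRV V₂ ⊆ annihilator p (asRV V)) (hO : IsOpen O) (h0 : (0 : B p) ∈ O)
    (hH : ∀ b ∈ V₂, b ∈ O → IsGradK p (H b) (B.rv b)) (hHc : ContDiffOn ℝ ∞ H O) :
    ∃ (σ : OpenPartialHomeomorph (B p) (V₂ × V)) (O₁ : Set V₂) (O₂ : Set V),
      IsFlattening (coords p (MF V)) σ O₁ O₂ ∧ σ.source ⊆ S p ∧ 0 ∈ σ.source := by
  have hV₂ : IsClosed (V₂ : Set (B p)) := h.symm.isClosed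
  have hV : IsClosed (V : Set (B p)) := h.isClosed
  have : CompleteSpace V₂ := hV₂.completeSpace_coe
  have : CompleteSpace V := hV.completeSpace_coe
  let i₁ : (V₂ × V) →L[ℝ] B p := V₂.subtypeL.comp (ContinuousLinearMap.fst ℝ V₂ V)
  let i₂ : (V₂ × V) →L[ℝ] B p := V.subtypeL.comp (ContinuousLinearMap.snd ℝ V₂ V)
  let f : V₂ × V → B p := fun x => i₂ x + H (i₁ x)
  have hH0 : H 0 = 0 := eq_zero_of_isGradK_zero (hH 0 V₂.zero_mem h0)
  have hf0 : f 0 = 0 := by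
    change i₂ 0 + H (i₁ 0) = 0
    rw [map_zero, map_zero, hH0, add_zero]
  have hd : HasFDerivAt H (fderiv ℝ H 0) (i₁ 0) := by
    rw [map_zero]
    exact ((hHc.contDiffAt (hO.mem_nhds h0)).differentiableAt (by simp)).hasFDerivAt
  have hf' : HasFDerivAt f
      (Submodule.prodEquivOfIsTopCompl V₂ V h.symm : (V₂ × V) →L[ℝ] B p) 0 := by
    refine (i₂.hasFDerivAt.add (HasFDerivAt.comp 0 hd i₁.hasFDerivAt)).congr_fderiv ?_
    refine ContinuousLinearMap.ext fun x => ?_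
    change (x.2 : B p) + fderiv ℝ H 0 (x.1 : B p) = (x.1 : B p) + (x.2 : B p)
    rw [map_zero] at hd
    rw [fderiv_gradK_section hO h0 hH hd x.1.2, add_comm]
  have key := exists_isFlattening_of_hasFDerivAt (M := coords p (MF V)) h.symm (f := f)
    (hO.preimage i₁.continuous) (by rw [mem_preimage, map_zero]; exact h0)
    (i₂.contDiff.contDiffOn.add (hHc.comp i₁.contDiff.contDiffOn fun _ hx => hx)) hf'
    (isOpen_S p) (by rw [hf0]; exact zero_mem_S p) fun x hx hS => by
      have hg := hH x.1 x.1.2 hx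
      rw [mem_coords_iff hS]
      exact (expMap_add_mem_MF_iff ⟨H x.1, hg.1⟩
        (expMap_mem_MF_of_isGradK horth x.1.2 hg) x.2.2 hS).trans Submodule.coe_eq_zero
  rwa [hf0] at key

/-- The projection onto `V₂` is the identity on `V₂`, so there `H` is a smooth section of `∇K_p`. -/
lemma IsMixedDiffeoAt.exists_section {h : Submodule.IsTopCompl V V₂}
    (hd : IsMixedDiffeoAt p V V₂ h) :
    ∃ (O : Set (B p)) (H : B p → B p), IsOpen O ∧ (0 : B p) ∈ O ∧
      (∀ b ∈ V₂, b ∈ O → IsGradK p (H b) (B.rv b)) ∧ ContDiffOn ℝ ∞ H O := by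
  obtain ⟨O, H, hO, h0, -, hH, hc, -⟩ := hd
  refine ⟨O, H, hO, h0, fun b hb hbO => ?_, contDiff_snd.comp_contDiffOn hc⟩
  have := hH b hbO
  rwa [Submodule.projectionL_apply_left h.symm ⟨b, hb⟩] at this

lemma tangentAt_MF {h : Submodule.IsTopCompl V V₂}
    (horth : asRV V₂ ⊆ annihilator p (asRV V)) (hd : IsMixedDiffeoAt p V V₂ h) :
    tangentAt p (MF V) p = asRV V₂ := by
  obtain ⟨O, H, hO, h0, hH, hc⟩ := hd.exists_section
  exact (tangentAt_MF_subset h.isCompl horth).antisymm (subset_tangentAt_MF horth hO h0 hH hc)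

end MixedDiffeo

/-! ### Changing the base point of a mixture family -/

/-- At a point of the family the elements of `V` are already centered, so transport fixes them; the
maximal exponential family does not depend on its base point. This reduces the global statement to
the local one at each `q`. -/
lemma MF_eq_of_asRV_eq_parallel {p : PosDensity μ} {V : Submodule ℝ (B p)} (w : S p)
    (hw : expMap p w ∈ MF V) {W : Submodule ℝ (B (expMap p w))}
    (hW : asRV W = parallel V (expMap p w)) : MF W = MF V := by
  have hpar : parallel V (expMap p w) = asRV V := by
    have he (U : B p) (hU : U ∈ V) : eTransport (expMap p w) (B.rv U) = B.rv U :=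
      eTransport_eq_self ((mem_MF_iff w).1 hw U hU)
    ext X
    constructor
    · rintro ⟨_, ⟨U, hU, rfl⟩, rfl⟩
      exact ⟨U, hU, (he U hU).symm⟩
    · rintro ⟨U, hU, rfl⟩
      exact ⟨_, ⟨U, hU, rfl⟩, he U hU⟩
  rw [hpar] at hW
  have hmem {r s : PosDensity μ} (A : Submodule ℝ (B r)) :
      (∀ U ∈ A, expect s (B.rv U) = 0) ↔ ∀ X ∈ asRV A, expect s X = 0 :=
    ⟨by rintro h _ ⟨U, hU, rfl⟩; exact h U hU, fun h U hU => h _ ⟨U, hU, rfl⟩⟩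
  ext r
  change r ∈ maxExp _ ∧ _ ↔ r ∈ maxExp p ∧ _
  rw [maxExp_expMap, hmem, hmem, hW]

end ExpManifold

end

open ExpManifold MeasureTheory in
theorem mainTheorem7 {Ω : Type*} [MeasurableSpace Ω] (μ : Measure Ω) (p : PosDensity μ)
    (V : Submodule ℝ (B p)) (hV : IsClosed (V : Set (B p))) :
    -- the unique intersection of the two families is `p`
    EF V ∩ MF V = {p} ∧
    -- the space of scores at `q` of the regular curves in the exponential family is `V_q`
    (∀ q ∈ EF V, tangentAt p (EF V) q = parallel V q) ∧
    -- a regular curve in the mixture family has, at each of its points `r`, a unique score,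
    -- which lies in the annihilator of `V_r`
    (∀ (I : Set ℝ) (γ : ℝ → PosDensity μ) (t : ℝ), IsRegularCurve p I γ →
      (∀ s ∈ I, γ s ∈ MF V) → t ∈ I →
      ∃ W ∈ annihilator (γ t) (parallel V (γ t)), ∀ W', IsScoreAt γ t W' ↔ W' = W) ∧
    -- if `V` splits, the exponential families of both components are sub-manifolds
    (∀ V₂ : Submodule ℝ (B p), Submodule.IsTopCompl V V₂ →
      IsSubmanifold p (EF V) ∧ tangentAt p (EF V) p = asRV V ∧
      IsSubmanifold p (EF V₂) ∧ tangentAt p (EF V₂) p = asRV V₂) ∧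
    -- under the local diffeomorphism assumption at `p`, the mixture family is a sub-manifold
    -- around `p`, with tangent space `V₂` at `p`
    (∀ (V₂ : Submodule ℝ (B p)) (h : Submodule.IsTopCompl V V₂),
      asRV V₂ ⊆ annihilator p (asRV V) → IsMixedDiffeoAt p V V₂ h →
      tangentAt p (MF V) p = asRV V₂ ∧
      ∃ O : Set (B p), IsOpen O ∧ (0 : B p) ∈ O ∧ O ⊆ S p ∧
        IsSubmanifold p (MF V ∩ expMap p '' (Subtype.val ⁻¹' O))) ∧
    -- under the same assumption at every point of the mixture family, all of it is a sub-manifold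
    (∀ (W₁ W₂ : ∀ q : PosDensity μ, Submodule ℝ (B q)),
      (∀ q ∈ MF V, asRV (W₁ q) = parallel V q ∧
        asRV (W₂ q) ⊆ annihilator q (parallel V q) ∧
        ∃ h : Submodule.IsTopCompl (W₁ q) (W₂ q), IsMixedDiffeoAt q (W₁ q) (W₂ q) h) →
      IsSubmanifold p (MF V) ∧ ∀ q ∈ MF V, tangentAt p (MF V) q = asRV (W₂ q)) := by
  refine ⟨EF_inter_MF V, fun q hq => tangentAt_EF hV hq,
    fun I γ t hγ hN ht => exists_unique_score_MF hγ hN ht, fun V₂ h => ?_, fun V₂ h horth hd => ?_,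
    fun W₁ W₂ hW => ?_⟩
  · have hp {A : Submodule ℝ (B p)} : p ∈ EF A :=
      ((EF_inter_MF A).symm ▸ Set.mem_singleton p : p ∈ EF A ∩ MF A).1
    refine ⟨isSubmanifold_EF h, ?_, isSubmanifold_EF h.symm, ?_⟩
    · rw [tangentAt_EF hV hp, parallel_self]
    · rw [tangentAt_EF h.symm.isClosed hp, parallel_self]
  · refine ⟨tangentAt_MF horth hd, ?_⟩
    obtain ⟨O, H, hO, h0, hH, hc⟩ := hd.exists_section
    obtain ⟨σ, O₁, O₂, hσ, hS, hσ0⟩ := exists_isFlattening_MF h horth hO h0 hH hc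
    exact ⟨σ.source, σ.open_source, hσ0, hS, hσ.isSubmanifold h.symm hS⟩
  · refine ⟨⟨fun q hq => hq.1, fun q hq => ?_⟩, fun q hq => ?_⟩
    · obtain ⟨w, rfl⟩ := hq.1
      obtain ⟨hpar, horth, h, hd⟩ := hW _ hq
      -- The local result is applied with `q` as base and `V_q` as subspace, then read back as a
      -- statement on `MF V`.
      rw [← hpar] at horth
      obtain ⟨O, H, hO, h0, hH, hc⟩ := hd.exists_section
      obtain ⟨σ, O₁, O₂, hσ, hS, hσ0⟩ := exists_isFlattening_MF h horth hO h0 hH hc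
      rw [MF_eq_of_asRV_eq_parallel w hq hpar] at hσ
      exact ⟨_, _, h.symm, hσ.hasSplittingChartAt hS hσ0⟩
    · obtain ⟨w, rfl⟩ := hq.1
      obtain ⟨hpar, horth, h, hd⟩ := hW _ hq
      rw [← hpar] at horth
      rw [← tangentAt_MF horth hd, tangentAt_expMap, MF_eq_of_asRV_eq_parallel w hq hpar]
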